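/- Let $k$ be a totally real number field of degree $n$ over $\mathbb{Q}$, with ring of integers $\mathcal{O}_k$ and embeddings $\sigma_1,\dots,\sigma_n : k\to\mathbb{R}$, and let $G=PSL_2(\mathcal{O}_k)=SL_2(\mathcal{O}_k)/\{\pm I\}$. For $\alpha\in G$ the components of $\alpha$ are the elements $\sigma_1(\alpha),\dots,\sigma_n(\alpha)$ of $PSL_2(\mathbb{R})$ obtained by applying the embeddings to the entries. An element $g\in PSL_2(\mathbb{R})$ is called hyperbolic if $\operatorname{Tr}(g)^2>4$, and parabolic if $g\neq 1$ and $\operatorname{Tr}(g)^2=4$; an element of $G$ is called totally hyperbolic (totally parabolic) if all its components are hyperbolic (parabolic). An element $\alpha\in G$ is called hyperbolic-parabolic if it is totally hyperbolic and some point of $(\mathbb{R}\cup\{\infty\})^n$ fixed by $(\sigma_1(\alpha),\dots,\sigma_n(\alpha))$ (acting componentwise by Möbius transformations) is also fixed by some totally parabolic element of $G$. For a subgroup $L\le G$, let $[L]$ be the set of infinite virtually cyclic subgroups $K\le G$ such that $L\cap K$ is infinite, and let $N_G[L]=\{g\in G : [g^{-1}Lg]=[L]\}$ be the commensurator of $L$;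 let $N_G(L)$ be the normalizer of $L$. Proposition. Let $\alpha\in G$ have exactly $m$ hyperbolic components, where $1\le m\le n$, and let $H=\langle\alpha\rangle$. Then $H$ is infinite cyclic and $N_G[H]=N_G(H)$. If $\alpha$ is not hyperbolic-parabolic, then $N_G(H)$ is isomorphic to $\mathbb{Z}^m$ or to $\mathbb{Z}^m\rtimes\mathbb{Z}/2$. If $\alpha$ is hyperbolic-parabolic, then $N_G(H)$ is isomorphic to $\mathbb{Z}^{n-1}$ or to $\mathbb{Z}^{n-1}\rtimes\mathbb{Z}/2$. In the semidirect products the nontrivial element of $\mathbb{Z}/2$ acts by multiplication by $-1$; in particular, $\mathbb{Z}/2$ acts freely away from the origin. -/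

import Mathlib

open scoped MatrixGroups NumberField

namespace HilbertModular

/-! ### Commensurators of infinite virtually cyclic subgroups -/

section Commensurator

variable {G : Type*} [Group G]

/-- `H` is an infinite virtually cyclic subgroup: it is infinite and contains a cyclic subgroup of
finite index. -/
def IsInfiniteVirtuallyCyclic (H : Subgroup G) : Prop :=
  Infinite H ∧ ∃ C : Subgroup H, IsCyclic C ∧ C.FiniteIndex

/-- The conjugate subgroup `g⁻¹ H g`. -/
def conjSubgroup (g : G) (H : Subgroup G) : Subgroup G :=
  H.map (MulAut.conj g⁻¹).toMonoidHom

/-- The class `[H]`: all infinite virtually cyclic subgroups `K` such that `H ∩ K` is infinite. -/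
def virtClass (H : Subgroup G) : Set (Subgroup G) :=
  {K | IsInfiniteVirtuallyCyclic K ∧ Infinite (H ⊓ K : Subgroup G)}

theorem conjSubgroup_one (H : Subgroup G) : conjSubgroup 1 H = H := by
  ext x; simp [conjSubgroup]

theorem conjSubgroup_mul (g h : G) (H : Subgroup G) :
    conjSubgroup (g * h) H = conjSubgroup h (conjSubgroup g H) := by
  simp only [conjSubgroup, Subgroup.map_map]
  congr 1
  ext x
  simp [mul_assoc]

/-- Conjugation by `g`, as an isomorphism from `H` to `g⁻¹ H g`. -/
noncomputable def conjEquiv (g : G) (H : Subgroup G) : H ≃* conjSubgroup g H :=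
  H.equivMapOfInjective _ (MulAut.conj g⁻¹).injective

theorem IsInfiniteVirtuallyCyclic.conj {H : Subgroup G} (h : IsInfiniteVirtuallyCyclic H) (g : G) :
    IsInfiniteVirtuallyCyclic (conjSubgroup g H) := by
  obtain ⟨hinf, C, hC, hfin⟩ := h
  refine ⟨(conjEquiv g H).toEquiv.infinite_iff.mp hinf,
    C.map (conjEquiv g H).toMonoidHom, ?_, ?_⟩
  · exact isCyclic_of_surjective
      (C.equivMapOfInjective (conjEquiv g H).toMonoidHom (conjEquiv g H).injective)
      (MulEquiv.surjective _)
  · constructor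
    rw [Subgroup.index_map_of_bijective (f := (conjEquiv g H).toMonoidHom)
      (conjEquiv g H).bijective]
    exact hfin.index_ne_zero

theorem conj_mem_virtClass {H K : Subgroup G} (h : K ∈ virtClass H) (g : G) :
    conjSubgroup g K ∈ virtClass (conjSubgroup g H) := by
  refine ⟨h.1.conj g, ?_⟩
  have e : conjSubgroup g H ⊓ conjSubgroup g K = conjSubgroup g (H ⊓ K) :=
    (Subgroup.map_inf H K _ (MulAut.conj g⁻¹).injective).symm
  rw [e]
  exact (conjEquiv g (H ⊓ K)).toEquiv.infinite_iff.mp h.2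

theorem virtClass_conj_eq {H K : Subgroup G} (h : virtClass H = virtClass K) (g : G) :
    virtClass (conjSubgroup g H) = virtClass (conjSubgroup g K) := by
  have key : ∀ {A B : Subgroup G}, virtClass A = virtClass B →
      virtClass (conjSubgroup g A) ⊆ virtClass (conjSubgroup g B) := by
    intro A B hAB L hL
    have h1 := conj_mem_virtClass hL g⁻¹
    rw [← conjSubgroup_mul, mul_inv_cancel, conjSubgroup_one, hAB] at h1
    have h2 := conj_mem_virtClass h1 g
    rwa [← conjSubgroup_mul, inv_mul_cancel, conjSubgroup_one] at h2
  exact Set.Subset.antisymm (key h) (key h.symm)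

/-- The commensurator `N_G[H] = {g ∈ G | [g⁻¹ H g] = [H]}`, as a subgroup of `G`. -/
def commensurator (H : Subgroup G) : Subgroup G where
  carrier := {g | virtClass (conjSubgroup g H) = virtClass H}
  one_mem' := by simp [conjSubgroup_one]
  mul_mem' := by
    intro a b ha hb
    have ha' : virtClass (conjSubgroup a H) = virtClass H := ha
    have hb' : virtClass (conjSubgroup b H) = virtClass H := hb
    change virtClass (conjSubgroup (a * b) H) = virtClass H
    rw [conjSubgroup_mul, virtClass_conj_eq ha' b, hb']
  inv_mem' := by
    intro a ha
    have ha' : virtClass (conjSubgroup a H) = virtClass H := ha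
    change virtClass (conjSubgroup a⁻¹ H) = virtClass H
    rw [← virtClass_conj_eq ha' a⁻¹, ← conjSubgroup_mul, mul_inv_cancel, conjSubgroup_one]

end Commensurator

/-! ### `PSL(2, R)` : trace squared, functoriality, action on the boundary -/

/-- The square of the trace of a class in `PSL(2, R)`; it does not depend on the representative. -/
def trSq {R : Type*} [CommRing R] : PSL(2, R) → R :=
  Quotient.lift (fun A : SL(2, R) => (Matrix.trace (A : Matrix (Fin 2) (Fin 2) R)) ^ 2) <| by
    intro A B hAB
    have h := QuotientGroup.leftRel_apply.mp hAB
    obtain ⟨r, hr, hrZ⟩ := Matrix.SpecialLinearGroup.mem_center_iff.mp h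
    have hB : (B : Matrix (Fin 2) (Fin 2) R) = r • (A : Matrix (Fin 2) (Fin 2) R) := by
      have : B = A * (A⁻¹ * B) := by group
      rw [this, Matrix.SpecialLinearGroup.coe_mul, ← hrZ, Matrix.scalar_apply,
        ← Matrix.smul_one_eq_diagonal, Matrix.mul_smul, mul_one]
    have hr2 : r ^ 2 = 1 := by simpa using hr
    simp only [hB, Matrix.trace_smul, smul_eq_mul, mul_pow, hr2, one_mul]

/-- The homomorphism `PSL(2, R) → PSL(2, S)` induced by applying a ring homomorphism to the
entries. -/
def pslMap {R S : Type*} [CommRing R] [CommRing S] (f : R →+* S) : PSL(2, R) →* PSL(2, S) :=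
  QuotientGroup.map _ _ (Matrix.SpecialLinearGroup.map f) <| by
    intro A hA
    obtain ⟨r, hr, hrA⟩ := Matrix.SpecialLinearGroup.mem_center_iff.mp hA
    refine Matrix.SpecialLinearGroup.mem_center_iff.mpr ⟨f r, by rw [← map_pow, hr, map_one], ?_⟩
    ext i j
    simp [← hrA, Matrix.diagonal_apply, apply_ite f]

/-- The action of `PSL(2, ℝ)` on `ℝ ∪ {∞}` by Möbius transformations, as a homomorphism to the
permutations of `ℝ ∪ {∞}`. It is induced by the action of `GL(2, ℝ)`. -/
noncomputable def boundaryAction : PSL(2, ℝ) →* Equiv.Perm (OnePoint ℝ) :=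
  QuotientGroup.lift _
    ((MulAction.toPermHom (GL (Fin 2) ℝ) (OnePoint ℝ)).comp Matrix.SpecialLinearGroup.toGL) <| by
    intro A hA
    obtain ⟨r, hr, hrA⟩ := Matrix.SpecialLinearGroup.mem_center_iff.mp hA
    have hr0 : r ≠ 0 := by
      rintro rfl
      simp at hr
    ext x
    induction x using OnePoint.rec with
    | infty => simp [OnePoint.smul_infty_eq_ite, ← hrA]
    | coe x => simp [OnePoint.smul_some_eq_ite, ← hrA, hr0]

/-- `g ∈ PSL(2, ℝ)` is hyperbolic: `Tr(g)² > 4`. -/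
def IsHyperbolic (g : PSL(2, ℝ)) : Prop := 4 < trSq g

/-- `g ∈ PSL(2, ℝ)` is parabolic: `Tr(g)² = 4` and `g` is not the identity. -/
def IsParabolic (g : PSL(2, ℝ)) : Prop := g ≠ 1 ∧ trSq g = 4

/-! ### The reduced Hilbert modular group -/

section Hilbert

variable {k : Type*} [Field k]

/-- The map `PSL(2, 𝓞 k) → ∏_σ PSL(2, ℝ)`, where `σ` runs over the embeddings `k → ℝ`, given by
applying the embeddings to the entries. If `k` is totally real of degree `n`, there are exactly `n`
such embeddings. -/
noncomputable def hilbertEmbedding : PSL(2, 𝓞 k) →* ((k →+* ℝ) → PSL(2, ℝ)) :=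
  MonoidHom.pi fun σ => pslMap (σ.comp (algebraMap (𝓞 k) k))

/-- The number of hyperbolic components of `α`. -/
noncomputable def numHyperbolicComponents (α : PSL(2, 𝓞 k)) : ℕ :=
  Set.ncard {σ : k →+* ℝ | IsHyperbolic (hilbertEmbedding α σ)}

/-- All components of `α` are hyperbolic. -/
def IsTotallyHyperbolic (α : PSL(2, 𝓞 k)) : Prop :=
  ∀ σ : k →+* ℝ, IsHyperbolic (hilbertEmbedding α σ)

/-- All components of `α` are parabolic. -/
def IsTotallyParabolic (α : PSL(2, 𝓞 k)) : Prop :=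
  ∀ σ : k →+* ℝ, IsParabolic (hilbertEmbedding α σ)

/-- `α` fixes the point `x` of `(ℝ ∪ {∞})ⁿ`, under the componentwise action. -/
def FixesPoint (α : PSL(2, 𝓞 k)) (x : (k →+* ℝ) → OnePoint ℝ) : Prop :=
  ∀ σ : k →+* ℝ, boundaryAction (hilbertEmbedding α σ) (x σ) = x σ

/-- `α` is hyperbolic-parabolic: it is totally hyperbolic and fixes a point of `(ℝ ∪ {∞})ⁿ` that is
also fixed by some totally parabolic element of `PSL(2, 𝓞 k)`. -/
def IsHyperbolicParabolic (α : PSL(2, 𝓞 k)) : Prop :=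
  IsTotallyHyperbolic α ∧
    ∃ x : (k →+* ℝ) → OnePoint ℝ, FixesPoint α x ∧
      ∃ β : PSL(2, 𝓞 k), IsTotallyParabolic β ∧ FixesPoint β x

end Hilbert

/-! ### The groups `ℤʳ` and `ℤʳ ⋊ ℤ/2` -/

/-- The group `ℤʳ`, written multiplicatively. -/
abbrev FreeAb (r : ℕ) : Type := Multiplicative (Fin r → ℤ)

/-- The action of `ℤ/2` on `ℤʳ` in which the nontrivial element acts as multiplication by `-1`
(that is, as inversion in multiplicative notation). -/
def negAction (r : ℕ) : Multiplicative (ZMod 2) →* MulAut (FreeAb r) where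
  toFun a := if a = 1 then 1 else MulEquiv.inv (FreeAb r)
  map_one' := if_pos rfl
  map_mul' a b := by
    have h : ∀ c : Multiplicative (ZMod 2), c = 1 ∨ c = Multiplicative.ofAdd 1 := by decide
    have h1 : (Multiplicative.ofAdd 1 : Multiplicative (ZMod 2)) ≠ 1 := by decide
    have h2 : (Multiplicative.ofAdd 1 * Multiplicative.ofAdd 1 : Multiplicative (ZMod 2)) = 1 := by
      decide
    rcases h a with rfl | rfl <;> rcases h b with rfl | rfl
    · simp
    · simp [h1]
    · simp [h1]
    · rw [h2, if_pos rfl, if_neg h1]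
      ext x
      simp

/-- The semidirect product `ℤʳ ⋊ ℤ/2` with respect to multiplication by `-1`. -/
abbrev FreeAbSemidirect (r : ℕ) : Type := FreeAb r ⋊[negAction r] Multiplicative (ZMod 2)

end HilbertModular

open HilbertModular

/-! Lift `α` to `A` in `SL(2, 𝓞 k)` with trace `t`. A hyperbolic component gives `t ^ 2 ≠ 4` and `t
≠ 0`, and makes `α` of infinite order, since an eigenvalue at that place has absolute value other
than 1. So no nonzero power of `A` is scalar, and each has the same centralizer as `A` in the
matrices over `k`, namely the commutative algebra `k[A]`.

Conjugation. If `g` conjugates a nonzero power of `α` to a power of `α`, then `g A g⁻¹` commutes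
with `A` and has the same trace, hence is `A` or `A⁻¹` (`psl_conj`). This makes the commensurator
equal to the normalizer, and the centralizer has index at most 2 in it. An element `s` with `s A s⁻¹
= A⁻¹` induces on `k[A]` the canonical involution, so it inverts every element of determinant 1, and
`s ^ 2 = ±1` (`psl_flip`). In `PSL` the extension therefore splits, with `ℤ/2` acting by inversion.

Rank. Up to finite index the centralizer is the group of norm 1 units of `k[ω]`, where `ω ^ 2 = t ω
- 1`; an eigenvalue embeds it, modulo `±1`, into units modulo torsion. If the polynomial has a root
in `k`, the eigenvalues have finite index in the units of `k`, of rank `n - 1` by Dirichlet.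
Otherwise `K = k[ω]` is a quadratic extension field with `2m` real and `n - m` complex places, and
the kernel of the norm from `K` to `k` has rank `(n + m - 1) - (n - 1) = m`.

Finally, a root in `k` exists exactly when `α` is hyperbolic-parabolic: the fixed point of a
parabolic element is rational over `k`, and conversely a `k`-rational fixed point of `A` is fixed by
an explicit parabolic matrix (`exists_root_of_isHyperbolicParabolic`,
`isHyperbolicParabolic_of_root`). -/

namespace HilbertModular

/-! ### Commensurators and normalizers of infinite cyclic groups -/

section Group

variable {G : Type*} [Group G]

theorem isInfiniteVirtuallyCyclic_zpowers {α : G} (h : Infinite (Subgroup.zpowers α)) :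
    IsInfiniteVirtuallyCyclic (Subgroup.zpowers α) :=
  ⟨h, ⊤, Subgroup.topEquiv.symm.isCyclic.mp inferInstance, inferInstance⟩

theorem conjSubgroup_zpowers (g α : G) :
    conjSubgroup g (Subgroup.zpowers α) = Subgroup.zpowers (g⁻¹ * α * g) := by
  rw [conjSubgroup, MonoidHom.map_zpowers]
  simp

/-- The cyclic group lies in its own class, hence in the class of its conjugate; any nontrivial
element of the infinite intersection gives the relation. -/
theorem exists_zpow_conj_of_mem_commensurator {α g : G} (h : Infinite (Subgroup.zpowers α))
    (hg : g ∈ commensurator (Subgroup.zpowers α)) :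
    ∃ a b : ℤ, a ≠ 0 ∧ g⁻¹ * α ^ a * g = α ^ b := by
  have hg' : virtClass (conjSubgroup g (Subgroup.zpowers α)) = virtClass (Subgroup.zpowers α) := hg
  have hmem : Subgroup.zpowers α ∈ virtClass (Subgroup.zpowers α) :=
    ⟨isInfiniteVirtuallyCyclic_zpowers h, by rwa [inf_idem]⟩
  rw [← hg'] at hmem
  have hinf := hmem.2
  obtain ⟨⟨x, hx⟩, hx1⟩ := exists_ne (1 : ((conjSubgroup g (Subgroup.zpowers α) ⊓
    Subgroup.zpowers α : Subgroup G)))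
  obtain ⟨hxa, hxb⟩ := Subgroup.mem_inf.mp hx
  rw [conjSubgroup_zpowers] at hxa
  obtain ⟨a, rfl⟩ := Subgroup.mem_zpowers_iff.mp hxa
  obtain ⟨b, hb⟩ := Subgroup.mem_zpowers_iff.mp hxb
  have hc : (g⁻¹ * α * g) ^ a = g⁻¹ * α ^ a * g := by
    simpa using conj_zpow (a := g⁻¹) (b := α) (i := a)
  refine ⟨a, b, ?_, by rw [← hc, hb]⟩
  rintro rfl
  exact hx1 (by ext; simp)

theorem mem_normalizer_zpowers_of_conj {α g : G} (h : g * α * g⁻¹ = α ∨ g * α * g⁻¹ = α⁻¹) :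
    g ∈ Subgroup.normalizer (Subgroup.zpowers α : Set G) := by
  rw [Subgroup.mem_normalizer_iff_map_conj_eq, MonoidHom.map_zpowers]
  rcases h with h | h <;> simp [h]

theorem normalizer_le_commensurator (H : Subgroup G) :
    Subgroup.normalizer (H : Set G) ≤ commensurator H := by
  intro g hg
  have h1 : conjSubgroup g H = H := by
    have := Subgroup.mem_normalizer_iff_map_conj_eq.mp (inv_mem hg)
    simpa [conjSubgroup] using this
  change virtClass (conjSubgroup g H) = virtClass H
  rw [h1]

/-- The homomorphism `ℤ/2 → G` determined by an element of square `1`. -/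
def involutionHom (s : G) (hs : s * s = 1) : Multiplicative (ZMod 2) →* G where
  toFun a := if a = 1 then 1 else s
  map_one' := if_pos rfl
  map_mul' a b := by
    have h : ∀ c : Multiplicative (ZMod 2), c = 1 ∨ c = Multiplicative.ofAdd 1 := by decide
    have h1 : (Multiplicative.ofAdd 1 : Multiplicative (ZMod 2)) ≠ 1 := by decide
    have h2 : (Multiplicative.ofAdd 1 * Multiplicative.ofAdd 1 : Multiplicative (ZMod 2)) = 1 := by
      decide
    rcases h a with rfl | rfl <;> rcases h b with rfl | rfl
    · simp
    · simp [h1]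
    · simp [h1]
    · rw [h2, if_pos rfl, if_neg h1, hs]

theorem involutionHom_ofAdd_one (s : G) (hs : s * s = 1) :
    involutionHom s hs (Multiplicative.ofAdd 1) = s := by
  change (if (Multiplicative.ofAdd 1 : Multiplicative (ZMod 2)) = 1 then 1 else s) = s
  exact if_neg (by decide)

theorem negAction_of_ne_one (r : ℕ) {a : Multiplicative (ZMod 2)} (ha : a ≠ 1) :
    negAction r a = MulEquiv.inv (FreeAb r) := by
  change (if a = 1 then 1 else MulEquiv.inv (FreeAb r)) = _
  exact if_neg ha

theorem conj_mem_of_mem_normalizer_zpowers {α : G}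
    (hconj : ∀ (g : G) (a b : ℤ), a ≠ 0 → g⁻¹ * α ^ a * g = α ^ b →
      g * α * g⁻¹ = α ∨ g * α * g⁻¹ = α⁻¹)
    {g : G} (hg : g ∈ Subgroup.normalizer (Subgroup.zpowers α : Set G)) :
    g * α * g⁻¹ = α ∨ g * α * g⁻¹ = α⁻¹ := by
  have h1 : g⁻¹ * α * g ∈ Subgroup.zpowers α :=
    (Subgroup.mem_normalizer_iff''.mp hg α).mp (Subgroup.mem_zpowers α)
  obtain ⟨b, hb⟩ := Subgroup.mem_zpowers_iff.mp h1
  exact hconj g 1 b one_ne_zero (by rw [zpow_one, hb])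

theorem commensurator_zpowers_eq_normalizer {α : G} (h : Infinite (Subgroup.zpowers α))
    (hconj : ∀ (g : G) (a b : ℤ), a ≠ 0 → g⁻¹ * α ^ a * g = α ^ b →
      g * α * g⁻¹ = α ∨ g * α * g⁻¹ = α⁻¹) :
    commensurator (Subgroup.zpowers α) =
      Subgroup.normalizer (Subgroup.zpowers α : Set G) := by
  refine le_antisymm (fun g hg => ?_) (normalizer_le_commensurator _)
  obtain ⟨a, b, ha, hab⟩ := exists_zpow_conj_of_mem_commensurator h hg
  exact mem_normalizer_zpowers_of_conj (hconj g a b ha hab)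

/-- The centralizer has index at most 2 in the normalizer. If some `s` inverts `α`, it has order 2
and inverts the whole centralizer, so it supplies the complement `ℤ/2`; `hα` keeps `s` out of the
centralizer. -/
theorem normalizer_zpowers_equiv {α : G} (hα : α ≠ α⁻¹)
    (hconj : ∀ (g : G) (a b : ℤ), a ≠ 0 → g⁻¹ * α ^ a * g = α ^ b →
      g * α * g⁻¹ = α ∨ g * α * g⁻¹ = α⁻¹)
    (hflip : ∀ s : G, s * α * s⁻¹ = α⁻¹ →
      s * s = 1 ∧ ∀ x ∈ Subgroup.centralizer {α}, s * x * s⁻¹ = x⁻¹)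
    {r : ℕ} (e : Subgroup.centralizer {α} ≃* FreeAb r) :
    Nonempty (Subgroup.normalizer (Subgroup.zpowers α : Set G) ≃* FreeAb r) ∨
      Nonempty (Subgroup.normalizer (Subgroup.zpowers α : Set G) ≃* FreeAbSemidirect r) := by
  have hmem : ∀ g, g ∈ Subgroup.centralizer {α} ↔ g * α * g⁻¹ = α := by
    intro g
    rw [Subgroup.mem_centralizer_singleton_iff, mul_inv_eq_iff_eq_mul]
  have hle : Subgroup.centralizer {α} ≤ Subgroup.normalizer (Subgroup.zpowers α : Set G) :=
    fun g hg => mem_normalizer_zpowers_of_conj (Or.inl ((hmem g).mp hg))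
  by_cases hs : ∃ s : G, s * α * s⁻¹ = α⁻¹
  · right
    obtain ⟨s, hs⟩ := hs
    obtain ⟨hss, hsx⟩ := hflip s hs
    have hsN : s ∈ Subgroup.normalizer (Subgroup.zpowers α : Set G) :=
      mem_normalizer_zpowers_of_conj (Or.inr hs)
    have hsC : s ∉ Subgroup.centralizer {α} := fun h => hα (((hmem s).mp h).symm.trans hs)
    let f₁ : FreeAb r →* Subgroup.normalizer (Subgroup.zpowers α : Set G) :=
      (Subgroup.inclusion hle).comp e.symm.toMonoidHom
    let f₂ := involutionHom (⟨s, hsN⟩ : Subgroup.normalizer (Subgroup.zpowers α : Set G))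
      (Subtype.ext hss)
    have h01 : ∀ c : Multiplicative (ZMod 2), c = 1 ∨ c = Multiplicative.ofAdd 1 := by decide
    have h1 : (Multiplicative.ofAdd 1 : Multiplicative (ZMod 2)) ≠ 1 := by decide
    have hf₂ : f₂ (Multiplicative.ofAdd 1) = ⟨s, hsN⟩ :=
      involutionHom_ofAdd_one _ _
    have hf₁ : ∀ x, (f₁ x : G) = (e.symm x : G) := fun _ => rfl
    let F : FreeAbSemidirect r →* Subgroup.normalizer (Subgroup.zpowers α : Set G) :=
      SemidirectProduct.lift f₁ f₂ <| by
        intro c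
        refine MonoidHom.ext fun x => Subtype.ext ?_
        rcases h01 c with rfl | rfl
        · simp
        · rw [negAction_of_ne_one r h1, hf₂]
          change (e.symm x⁻¹ : G) = s * (e.symm x : G) * s⁻¹
          rw [hsx _ (e.symm x).2, map_inv]
          rfl
    have hF : ∀ x c, F ⟨x, c⟩ = f₁ x * f₂ c := fun _ _ => rfl
    refine ⟨(MulEquiv.ofBijective F ⟨?_, ?_⟩).symm⟩
    · rw [injective_iff_map_eq_one]
      rintro ⟨x, c⟩ hx
      rw [hF] at hx
      rcases h01 c with rfl | rfl
      · have hx' : e.symm x = 1 := by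
          apply Subtype.ext
          simpa [hf₁] using congrArg Subtype.val hx
        have : x = 1 := by simpa using hx'
        rw [this]; rfl
      · exfalso
        rw [hf₂] at hx
        have hx' : (e.symm x : G) * s = 1 := congrArg Subtype.val hx
        rw [eq_inv_of_mul_eq_one_right hx'] at hsC
        exact hsC (inv_mem (e.symm x).2)
    · rintro ⟨g, hg⟩
      rcases conj_mem_of_mem_normalizer_zpowers hconj hg with h | h
      · refine ⟨⟨e ⟨g, (hmem g).mpr h⟩, 1⟩, Subtype.ext ?_⟩
        rw [hF]
        simp [hf₁]
      -- Two elements inverting `α` differ by an element of the centralizer.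
      · have hgs : g * s⁻¹ ∈ Subgroup.centralizer {α} := by
          rw [hmem]
          have h2 : s⁻¹ * α * s = α⁻¹ := by
            rw [← inv_eq_of_mul_eq_one_right hss] at hs
            simpa using hs
          calc g * s⁻¹ * α * (g * s⁻¹)⁻¹ = g * (s⁻¹ * α * s) * g⁻¹ := by group
            _ = (g * α * g⁻¹)⁻¹ := by rw [h2]; group
            _ = α := by rw [h, inv_inv]
        refine ⟨⟨e ⟨_, hgs⟩, Multiplicative.ofAdd 1⟩, Subtype.ext ?_⟩
        rw [hF, hf₂]
        simp [hf₁]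
  · left
    have : Subgroup.normalizer (Subgroup.zpowers α : Set G) = Subgroup.centralizer {α} := by
      refine le_antisymm (fun g hg => (hmem g).mpr ?_) hle
      exact (conj_mem_of_mem_normalizer_zpowers hconj hg).resolve_right fun h => hs ⟨g, h⟩
    exact ⟨(MulEquiv.subgroupCongr this).trans e⟩

theorem negAction_ne_self (r : ℕ) (a : Multiplicative (ZMod 2)) (x : FreeAb r)
    (ha : a ≠ 1) (hx : x ≠ 1) : negAction r a x ≠ x := by
  rw [negAction_of_ne_one r ha]
  intro h
  apply hx
  have h2 : -(Multiplicative.toAdd x) = Multiplicative.toAdd x := h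
  have h3 : Multiplicative.toAdd x = 0 := by
    funext i
    have := congrFun h2 i
    simp only [Pi.neg_apply] at this
    simp only [Pi.zero_apply]
    omega
  exact h3

end Group

/-! ### Trace and inverse in `SL(2, R)` -/

section Trace

variable {R : Type*} [CommRing R]

theorem trace_conj (g A : SL(2, R)) :
    Matrix.trace ((g * A * g⁻¹ : SL(2, R)) : Matrix (Fin 2) (Fin 2) R) =
      Matrix.trace (A : Matrix (Fin 2) (Fin 2) R) := by
  rw [Matrix.SpecialLinearGroup.coe_mul, Matrix.trace_mul_comm,
    ← Matrix.SpecialLinearGroup.coe_mul]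
  simp

theorem trace_inv (A : SL(2, R)) :
    Matrix.trace ((A⁻¹ : SL(2, R)) : Matrix (Fin 2) (Fin 2) R) =
      Matrix.trace (A : Matrix (Fin 2) (Fin 2) R) := by
  rw [Matrix.SpecialLinearGroup.SL2_inv_expl, Matrix.trace_fin_two, Matrix.trace_fin_two]
  simp [add_comm]

theorem coe_inv_eq (A : SL(2, R)) :
    ((A⁻¹ : SL(2, R)) : Matrix (Fin 2) (Fin 2) R) =
      (A 0 0 + A 1 1) • 1 - (A : Matrix (Fin 2) (Fin 2) R) := by
  rw [Matrix.SpecialLinearGroup.SL2_inv_expl]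
  ext i j
  fin_cases i <;> fin_cases j <;> simp

end Trace

/-! ### Commuting and inverting conjugations for `2 × 2` matrices -/

section Matrices

variable {R : Type*} [CommRing R]

/-- A `2 × 2` matrix is not scalar. -/
def IsNonscalar (Z : Matrix (Fin 2) (Fin 2) R) : Prop :=
  Z 0 1 ≠ 0 ∨ Z 1 0 ≠ 0 ∨ Z 0 0 ≠ Z 1 1

/-- Over a field the centralizer of a nonscalar matrix is spanned by `1` and the matrix. Here `c` is
the denominator, one of the quantities whose nonvanishing makes `Z` nonscalar. -/
theorem exists_smul_eq_of_commute {Z M : Matrix (Fin 2) (Fin 2) R} (hZ : IsNonscalar Z)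
    (h : M * Z = Z * M) : ∃ c x y : R, c ≠ 0 ∧ c • M = x • 1 + y • Z := by
  have e00 := congrFun (congrFun h 0) 0
  have e01 := congrFun (congrFun h 0) 1
  have e10 := congrFun (congrFun h 1) 0
  simp only [Matrix.mul_apply, Fin.sum_univ_two] at e00 e01 e10
  rcases hZ with hZ | hZ | hZ
  · refine ⟨Z 0 1, Z 0 1 * M 0 0 - M 0 1 * Z 0 0, M 0 1, hZ, ?_⟩
    ext i j
    fin_cases i <;> fin_cases j <;> simp <;> grind
  · refine ⟨Z 1 0, Z 1 0 * M 0 0 - M 1 0 * Z 0 0, M 1 0, hZ, ?_⟩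
    ext i j
    fin_cases i <;> fin_cases j <;> simp <;> grind
  · refine ⟨Z 0 0 - Z 1 1, (Z 0 0 - Z 1 1) * M 0 0 - (M 0 0 - M 1 1) * Z 0 0, M 0 0 - M 1 1,
      sub_ne_zero.mpr hZ, ?_⟩
    ext i j
    fin_cases i <;> fin_cases j <;> simp <;> grind

variable [IsDomain R]

theorem commute_of_commute_isNonscalar {X Y Z : Matrix (Fin 2) (Fin 2) R} (hZ : IsNonscalar Z)
    (hX : X * Z = Z * X) (hY : Y * Z = Z * Y) : X * Y = Y * X := by
  obtain ⟨c, x, y, hc, h⟩ := exists_smul_eq_of_commute hZ hX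
  refine smul_right_injective _ hc ?_
  change c • (X * Y) = c • (Y * X)
  rw [← Matrix.smul_mul, ← Matrix.mul_smul, h]
  simp [add_mul, mul_add, hY]

theorem isNonscalar_of_ne {A : SL(2, R)} (h1 : A ≠ 1) (h2 : A ≠ -1) :
    IsNonscalar (A : Matrix (Fin 2) (Fin 2) R) := by
  by_contra h
  simp only [IsNonscalar, not_or, not_not] at h
  obtain ⟨h01, h10, h00⟩ := h
  have hdet := A.det_coe
  rw [Matrix.det_fin_two, h01, h00] at hdet
  have : (A 1 1 - 1) * (A 1 1 + 1) = 0 := by linear_combination hdet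
  rcases mul_eq_zero.mp this with h | h
  · apply h1
    ext i j
    fin_cases i <;> fin_cases j <;> simp <;> grind
  · apply h2
    ext i j
    fin_cases i <;> fin_cases j <;> simp <;> grind

/-- With `c X = x + y A`, comparing traces and determinants and eliminating `x` gives `(t ^ 2 - 4)(y
^ 2 - c ^ 2) = 0`. The sign of `y = ±c` decides between `A` and `A⁻¹ = t - A`. -/
theorem eq_or_eq_inv_of_commute {A X : SL(2, R)} (h2 : (2 : R) ≠ 0)
    (ht : Matrix.trace (A : Matrix (Fin 2) (Fin 2) R) ^ 2 ≠ 4)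
    (hA : IsNonscalar (A : Matrix (Fin 2) (Fin 2) R)) (h : X * A = A * X)
    (htr : Matrix.trace (X : Matrix (Fin 2) (Fin 2) R) =
      Matrix.trace (A : Matrix (Fin 2) (Fin 2) R)) : X = A ∨ X = A⁻¹ := by
  obtain ⟨c, x, y, hc, hX⟩ := exists_smul_eq_of_commute (M := (X : Matrix (Fin 2) (Fin 2) R)) hA
    (by rw [← Matrix.SpecialLinearGroup.coe_mul, h, Matrix.SpecialLinearGroup.coe_mul])
  have hdA := A.det_coe
  have hdX := X.det_coe
  have e00 := congrFun (congrFun hX 0) 0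
  have e01 := congrFun (congrFun hX 0) 1
  have e10 := congrFun (congrFun hX 1) 0
  have e11 := congrFun (congrFun hX 1) 1
  rw [Matrix.trace_fin_two] at ht htr
  rw [Matrix.trace_fin_two] at htr
  rw [Matrix.det_fin_two] at hdA hdX
  simp at e00 e01 e10 e11
  have hsum : c * (A 0 0 + A 1 1) = 2 * x + y * (A 0 0 + A 1 1) := by
    rw [← htr]; linear_combination e00 + e11 - y * htr
  have hdet : c ^ 2 = x ^ 2 + x * y * (A 0 0 + A 1 1) + y ^ 2 := by
    have : (c * X 0 0) * (c * X 1 1) - (c * X 0 1) * (c * X 1 0) = c ^ 2 := by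
      linear_combination c ^ 2 * hdX
    rw [e00, e11, e01, e10] at this
    linear_combination (-1 : R) * this + y ^ 2 * hdA
  have hyc : (y - c) * (y + c) = 0 := by
    have : ((A 0 0 + A 1 1) ^ 2 - 4) * ((y - c) * (y + c)) = 0 := by
      linear_combination 4 * hdet - (c * (A 0 0 + A 1 1) + 2 * x + y * (A 0 0 + A 1 1)) * hsum
    exact (mul_eq_zero.mp this).resolve_left (sub_ne_zero.mpr ht)
  rcases mul_eq_zero.mp hyc with hy | hy
  · left
    obtain rfl : y = c := sub_eq_zero.mp hy
    have hx : x = 0 := by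
      have : 2 * x = 0 := by linear_combination -hsum
      exact (mul_eq_zero.mp this).resolve_left h2
    rw [hx] at hX
    apply Subtype.ext
    refine smul_right_injective _ hc ?_
    simpa using hX
  · right
    obtain rfl : y = -c := eq_neg_of_add_eq_zero_left hy
    have hx : x = c * (A 0 0 + A 1 1) := by
      have : 2 * (x - c * (A 0 0 + A 1 1)) = 0 := by linear_combination -hsum
      exact sub_eq_zero.mp ((mul_eq_zero.mp this).resolve_left h2)
    apply Subtype.ext
    refine smul_right_injective _ hc ?_
    change c • (X : Matrix (Fin 2) (Fin 2) R) =
      c • ((A⁻¹ : SL(2, R)) : Matrix (Fin 2) (Fin 2) R)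
    rw [hX, coe_inv_eq, hx, smul_sub, smul_smul, neg_smul, sub_eq_add_neg]

/-- Inversion in `SL(2)` is the restriction of the linear map `Z ↦ tr Z - Z`. Conjugation by `s`
agrees with it on `1` and `A`, hence on every combination of them. -/
theorem conj_eq_inv_of_commute {A M s : SL(2, R)}
    (hA : IsNonscalar (A : Matrix (Fin 2) (Fin 2) R)) (hs : s * A * s⁻¹ = A⁻¹)
    (h : M * A = A * M) : s * M * s⁻¹ = M⁻¹ := by
  obtain ⟨c, x, y, hc, hM⟩ := exists_smul_eq_of_commute (M := (M : Matrix (Fin 2) (Fin 2) R)) hA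
    (by rw [← Matrix.SpecialLinearGroup.coe_mul, h, Matrix.SpecialLinearGroup.coe_mul])
  rw [mul_inv_eq_iff_eq_mul] at hs ⊢
  have hs' := congrArg (fun Z : SL(2, R) => (Z : Matrix (Fin 2) (Fin 2) R)) hs
  simp only [Matrix.SpecialLinearGroup.coe_mul] at hs'
  apply Subtype.ext
  refine smul_right_injective _ hc ?_
  change c • ((s * M : SL(2, R)) : Matrix (Fin 2) (Fin 2) R) =
    c • ((M⁻¹ * s : SL(2, R)) : Matrix (Fin 2) (Fin 2) R)
  have hinv : c • ((M⁻¹ : SL(2, R)) : Matrix (Fin 2) (Fin 2) R) =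
      x • 1 + y • ((A⁻¹ : SL(2, R)) : Matrix (Fin 2) (Fin 2) R) := by
    have e00 := congrFun (congrFun hM 0) 0
    have e01 := congrFun (congrFun hM 0) 1
    have e10 := congrFun (congrFun hM 1) 0
    have e11 := congrFun (congrFun hM 1) 1
    simp at e00 e01 e10 e11
    rw [coe_inv_eq, coe_inv_eq]
    ext i j
    fin_cases i <;> fin_cases j <;> simp <;> grind
  rw [Matrix.SpecialLinearGroup.coe_mul, Matrix.SpecialLinearGroup.coe_mul, ← Matrix.mul_smul,
    ← Matrix.smul_mul, hM, hinv]
  simp [mul_add, add_mul, hs']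

/-- The square of `s` commutes with `A`, so conjugation by `s` inverts it, yet also fixes it. A
matrix of determinant 1 equal to its own adjugate is scalar when `2 ≠ 0`. -/
theorem mul_self_eq_of_conj_eq_inv {A s : SL(2, R)} (h2 : (2 : R) ≠ 0)
    (hA : IsNonscalar (A : Matrix (Fin 2) (Fin 2) R)) (hs : s * A * s⁻¹ = A⁻¹) :
    s * s = 1 ∨ s * s = -1 := by
  have hcomm : (s * s) * A = A * (s * s) := by
    have h1 : s * A = A⁻¹ * s := mul_inv_eq_iff_eq_mul.mp hs
    have h3 : s * A⁻¹ = A * s := by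
      have : (s * A * s⁻¹)⁻¹ = A := by rw [hs, inv_inv]
      rw [← mul_inv_eq_iff_eq_mul]
      simpa [mul_assoc] using this
    rw [mul_assoc, h1, ← mul_assoc, h3, mul_assoc]
  have h4 := conj_eq_inv_of_commute hA hs hcomm
  have h5 : s * s = (s * s)⁻¹ := by rw [← h4]; group
  by_contra! hne
  have h6 := isNonscalar_of_ne hne.1 hne.2
  have h7 := congrArg (fun Z : SL(2, R) => (Z : Matrix (Fin 2) (Fin 2) R)) h5
  simp only [coe_inv_eq] at h7
  have e00 := congrFun (congrFun h7 0) 0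
  have e01 := congrFun (congrFun h7 0) 1
  have e10 := congrFun (congrFun h7 1) 0
  simp only [Matrix.sub_apply, Matrix.smul_apply, Matrix.one_apply, smul_eq_mul] at e00 e01 e10
  simp only [Fin.isValue, if_true, zero_ne_one, one_ne_zero, if_false, mul_one,
    mul_zero] at e00 e01 e10
  rcases h6 with h | h | h
  · exact h ((mul_eq_zero.mp (by linear_combination e01 : (2 : R) * _ = 0)).resolve_left h2)
  · exact h ((mul_eq_zero.mp (by linear_combination e10 : (2 : R) * _ = 0)).resolve_left h2)
  · exact h (by linear_combination e00)

end Matrices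

/-! ### Passing from `SL(2, R)` to `PSL(2, R)` -/

section PSL

variable {R : Type*} [CommRing R] [IsDomain R]

theorem psl_mk_eq_mk_iff {A B : SL(2, R)} : (A : PSL(2, R)) = B ↔ A = B ∨ A = -B := by
  rw [eq_comm, QuotientGroup.eq_iff_div_mem, Matrix.SpecialLinearGroup.mem_center_iff]
  constructor
  · rintro ⟨r, hr, h⟩
    have hr' : (r - 1) * (r + 1) = 0 := by
      have : r ^ 2 = 1 := by simpa using hr
      linear_combination this
    have hBA : B / A = 1 ∨ B / A = -1 := by
      rcases mul_eq_zero.mp hr' with h' | h'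
      · left
        apply Subtype.ext
        rw [← h, sub_eq_zero.mp h']
        simp
      · right
        apply Subtype.ext
        rw [← h, eq_neg_of_add_eq_zero_left h']
        ext i j
        fin_cases i <;> fin_cases j <;> simp
    rcases hBA with h' | h'
    · left; exact (div_eq_one.mp h').symm
    · right; rw [div_eq_iff_eq_mul] at h'; rw [h']; simp
  · rintro (rfl | rfl)
    · exact ⟨1, by simp, by simp⟩
    · refine ⟨-1, by simp, ?_⟩
      rw [div_eq_mul_inv, show B * (-B)⁻¹ = -1 by rw [mul_inv_eq_iff_eq_mul]; simp]
      ext i j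
      fin_cases i <;> fin_cases j <;> simp

theorem psl_mk_eq_one_iff {A : SL(2, R)} : (A : PSL(2, R)) = 1 ↔ A = 1 ∨ A = -1 :=
  psl_mk_eq_mk_iff (B := 1)

/-- An identity in `PSL` lifts up to sign; the sign `-1` would make the nonzero trace equal to its
negative. -/
theorem conj_lift {A B g : SL(2, R)}
    (ht0 : Matrix.trace (A : Matrix (Fin 2) (Fin 2) R) ≠ 0) (h2 : (2 : R) ≠ 0)
    (htr : Matrix.trace (B : Matrix (Fin 2) (Fin 2) R) =
      Matrix.trace (A : Matrix (Fin 2) (Fin 2) R))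
    (h : (g : PSL(2, R)) * A * (g : PSL(2, R))⁻¹ = B) : g * A * g⁻¹ = B := by
  have h' : ((g * A * g⁻¹ : SL(2, R)) : PSL(2, R)) = B := h
  refine (psl_mk_eq_mk_iff.mp h').resolve_right fun h3 => ?_
  have h4 := trace_conj g A
  rw [h3, Matrix.SpecialLinearGroup.coe_neg, Matrix.trace_neg, htr] at h4
  exact ht0 ((mul_eq_zero.mp (by linear_combination -h4 : (2 : R) * _ = 0)).resolve_left h2)

theorem mem_centralizer_iff_commute_lift {A g : SL(2, R)} (h2 : (2 : R) ≠ 0)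
    (ht0 : Matrix.trace (A : Matrix (Fin 2) (Fin 2) R) ≠ 0) :
    (g : PSL(2, R)) ∈ Subgroup.centralizer {(A : PSL(2, R))} ↔ g * A = A * g := by
  rw [Subgroup.mem_centralizer_singleton_iff]
  constructor
  · intro h
    have := conj_lift (A := A) (B := A) (g := g) ht0 h2 rfl (by rw [h]; group)
    rw [mul_inv_eq_iff_eq_mul] at this
    exact this
  · intro h
    exact congrArg (fun Z : SL(2, R) => (Z : PSL(2, R))) h

theorem psl_flip {A : SL(2, R)} (h2 : (2 : R) ≠ 0)
    (ht0 : Matrix.trace (A : Matrix (Fin 2) (Fin 2) R) ≠ 0)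
    (hA : IsNonscalar (A : Matrix (Fin 2) (Fin 2) R))
    (s : PSL(2, R)) (hs : s * A * s⁻¹ = (A : PSL(2, R))⁻¹) :
    s * s = 1 ∧ ∀ x ∈ Subgroup.centralizer {(A : PSL(2, R))}, s * x * s⁻¹ = x⁻¹ := by
  obtain ⟨s, rfl⟩ := QuotientGroup.mk_surjective s
  have hs' : s * A * s⁻¹ = A⁻¹ := conj_lift ht0 h2 (trace_inv A) hs
  refine ⟨psl_mk_eq_one_iff.mpr (mul_self_eq_of_conj_eq_inv h2 hA hs'), fun x hx => ?_⟩
  obtain ⟨M, rfl⟩ := QuotientGroup.mk_surjective x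
  have := conj_eq_inv_of_commute hA hs' ((mem_centralizer_iff_commute_lift h2 ht0).mp hx)
  exact congrArg (fun Z : SL(2, R) => (Z : PSL(2, R))) this

theorem psl_conj {A : SL(2, R)} (h2 : (2 : R) ≠ 0)
    (ht : Matrix.trace (A : Matrix (Fin 2) (Fin 2) R) ^ 2 ≠ 4)
    (hinf : ∀ a : ℤ, (A : PSL(2, R)) ^ a = 1 → a = 0)
    (g : PSL(2, R)) (a b : ℤ) (ha : a ≠ 0) (h : g⁻¹ * (A : PSL(2, R)) ^ a * g = A ^ b) :
    g * A * g⁻¹ = A ∨ g * A * g⁻¹ = (A : PSL(2, R))⁻¹ := by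
  obtain ⟨g, rfl⟩ := QuotientGroup.mk_surjective g
  have hns : ∀ n : ℤ, n ≠ 0 → IsNonscalar ((A ^ n : SL(2, R)) : Matrix (Fin 2) (Fin 2) R) := by
    intro n hn
    refine isNonscalar_of_ne (fun h => ?_) (fun h => ?_)
    · exact hn (hinf n (psl_mk_eq_one_iff.mpr (Or.inl h)))
    · exact hn (hinf n (psl_mk_eq_one_iff.mpr (Or.inr h)))
  have hAns := hns 1 one_ne_zero
  rw [zpow_one] at hAns
  have hcomm : ∀ X Y Z : SL(2, R), IsNonscalar (Z : Matrix (Fin 2) (Fin 2) R) → X * Z = Z * X →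
      Y * Z = Z * Y → X * Y = Y * X := by
    intro X Y Z hZ hX hY
    apply Subtype.ext
    exact commute_of_commute_isNonscalar hZ (congrArg Subtype.val hX) (congrArg Subtype.val hY)
  have h' : ((g⁻¹ * A ^ a * g : SL(2, R)) : PSL(2, R)) = ((A ^ b : SL(2, R)) : PSL(2, R)) := h
  have hX : (g⁻¹ * A ^ a * g) * A = A * (g⁻¹ * A ^ a * g) := by
    -- Up to sign the conjugate is `A ^ b`, so it commutes with `A`. Conjugating back, `g A g⁻¹`
    -- commutes with the nonscalar `A ^ a`, and hence with `A`.
    have hAb : A ^ b * A = A * A ^ b := ((Commute.refl A).zpow_left b).eq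
    rcases psl_mk_eq_mk_iff.mp h' with e | e <;> rw [e]
    · exact hAb
    · rw [neg_mul, mul_neg, hAb]
  have hY : (g * A * g⁻¹) * A ^ a = A ^ a * (g * A * g⁻¹) := by
    calc (g * A * g⁻¹) * A ^ a = g * (A * (g⁻¹ * A ^ a * g)) * g⁻¹ := by group
      _ = g * ((g⁻¹ * A ^ a * g) * A) * g⁻¹ := by rw [hX]
      _ = _ := by group
  have hfin := hcomm (g * A * g⁻¹) A (A ^ a) (hns a ha) hY ((Commute.refl A).zpow_right a).eq
  rcases eq_or_eq_inv_of_commute h2 ht hAns hfin (trace_conj g A) with e | e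
  · left; exact congrArg (fun Z : SL(2, R) => (Z : PSL(2, R))) e
  · right; exact congrArg (fun Z : SL(2, R) => (Z : PSL(2, R))) e

end PSL

/-! ### Recognizing free abelian groups by rank -/

section Rank

theorem finrank_eq_of_injective_of_torsion {M N : Type*} [AddCommGroup M] [AddCommGroup N]
    [Module.Finite ℤ N] (f : M →ₗ[ℤ] N) (hf : Function.Injective f)
    (h : ∀ y, ∃ n : ℕ, n ≠ 0 ∧ n • y ∈ LinearMap.range f) :
    Module.finrank ℤ M = Module.finrank ℤ N := by
  have h1 := (LinearMap.range f).finrank_quotient_add_finrank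
  have h2 : Module.finrank ℤ (N ⧸ LinearMap.range f) = 0 := by
    rw [Module.finrank_eq_zero_iff_isTorsion]
    intro x
    obtain ⟨y, rfl⟩ := Submodule.Quotient.mk_surjective _ x
    obtain ⟨n, hn, hy⟩ := h y
    refine ⟨⟨(n : ℤ), mem_nonZeroDivisors_of_ne_zero (by exact_mod_cast hn)⟩, ?_⟩
    change (n : ℤ) • Submodule.Quotient.mk (p := LinearMap.range f) y = _
    rw [← Submodule.Quotient.mk_smul, Submodule.Quotient.mk_eq_zero]
    simpa using hy
  rw [← h1, h2, zero_add]
  exact (LinearEquiv.ofInjective f hf).finrank_eq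

/-- The image of `C` is a subgroup of a free abelian group, hence free, and it has the rank of `L`
because its quotient in `L` is torsion. -/
theorem nonempty_equiv_freeAb {C V : Type*} [Group C] [CommGroup V]
    [Module.Free ℤ (Additive V)] [Module.Finite ℤ (Additive V)] (f : C →* V)
    (hf : Function.Injective f) (L : Submodule ℤ (Additive V))
    (h1 : ∀ c, Additive.ofMul (f c) ∈ L)
    (h2 : ∀ y ∈ L, ∃ n : ℕ, n ≠ 0 ∧ ∃ c, n • y = Additive.ofMul (f c)) :
    Nonempty (C ≃* FreeAb (Module.finrank ℤ L)) := by
  let S : Submodule ℤ (Additive V) := AddSubgroup.toIntSubmodule (f.range.toAddSubgroup)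
  have hS : ∀ y : Additive V, y ∈ S ↔ ∃ c, Additive.ofMul (f c) = y := fun y => Iff.rfl
  have hle : S ≤ L := by
    intro y hy
    obtain ⟨c, rfl⟩ := (hS y).mp hy
    exact h1 c
  have hrank : Module.finrank ℤ S = Module.finrank ℤ L := by
    refine finrank_eq_of_injective_of_torsion (Submodule.inclusion hle)
      (Submodule.inclusion_injective hle) fun y => ?_
    obtain ⟨n, hn, c, hc⟩ := h2 y y.2
    exact ⟨n, hn, ⟨⟨_, (hS _).mpr ⟨c, rfl⟩⟩, Subtype.ext hc.symm⟩⟩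
  let b := Module.finBasisOfFinrankEq ℤ S hrank
  have e1 : C ≃* f.range := MonoidHom.ofInjective hf
  let e2 : f.range ≃* Multiplicative S :=
    { toFun := fun x => Multiplicative.ofAdd ⟨Additive.ofMul x.1, x.2⟩
      invFun := fun y => ⟨Additive.toMul (Multiplicative.toAdd y).1, (Multiplicative.toAdd y).2⟩
      left_inv := fun _ => rfl
      right_inv := fun _ => rfl
      map_mul' := fun _ _ => rfl }
  exact ⟨(e1.trans e2).trans (AddEquiv.toMultiplicative b.equivFun.toAddEquiv)⟩

theorem nonempty_equiv_freeAb_of_surjective {C D V : Type*} [Group C] [Group D] [CommGroup V]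
    [Module.Free ℤ (Additive V)] [Module.Finite ℤ (Additive V)] (q : D →* C) (f : D →* V)
    (hq : Function.Surjective q) (hker : ∀ x, f x = 1 ↔ q x = 1) (L : Submodule ℤ (Additive V))
    (h1 : ∀ c, Additive.ofMul (f c) ∈ L)
    (h2 : ∀ y ∈ L, ∃ n : ℕ, n ≠ 0 ∧ ∃ c, n • y = Additive.ofMul (f c)) :
    Nonempty (C ≃* FreeAb (Module.finrank ℤ L)) := by
  let g : C →* V := q.liftOfSurjective hq ⟨f, fun x hx => (hker x).mpr hx⟩
  have hg : ∀ x, g (q x) = f x :=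
    fun x => MonoidHom.liftOfRightInverse_comp_apply _ _ _ _ x
  refine nonempty_equiv_freeAb g ?_ L ?_ ?_
  · rw [injective_iff_map_eq_one]
    intro c hc
    obtain ⟨x, rfl⟩ := hq c
    exact (hker x).mp (by rw [← hg, hc])
  · intro c
    obtain ⟨x, rfl⟩ := hq c
    rw [hg]; exact h1 x
  · intro y hy
    obtain ⟨n, hn, c, hc⟩ := h2 y hy
    exact ⟨n, hn, q c, by rw [hg, hc]⟩

end Rank

/-! ### Units modulo torsion and the relative norm -/

section Units

open NumberField NumberField.Units

variable {K : Type*} [Field K]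

theorem eq_one_or_neg_one_of_mem_torsion (φ : K →+* ℝ) {u : (𝓞 K)ˣ} (hu : u ∈ torsion K) :
    (u : K) = 1 ∨ (u : K) = -1 := by
  obtain ⟨n, hn, h⟩ := isOfFinOrder_iff_pow_eq_one.mp ((CommGroup.mem_torsion _).mp hu)
  have h1 : φ (u : K) ^ n = 1 := by
    rw [← map_pow, ← coe_pow, h, coe_one, map_one]
  rcases (pow_eq_one_iff_of_ne_zero hn.ne').mp h1 with h2 | ⟨h2, -⟩
  · left; exact φ.injective (by rw [h2, map_one])
  · right; exact φ.injective (by rw [h2, map_neg, map_one])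

variable (K) in
/-- The group of units of `K` modulo torsion. -/
def UnitsModTorsion : Type _ := (𝓞 K)ˣ ⧸ torsion K

noncomputable instance : CommGroup (UnitsModTorsion K) := QuotientGroup.Quotient.commGroup _

/-- The class of a unit modulo torsion. -/
noncomputable def unitsModTorsionMk : (𝓞 K)ˣ →* UnitsModTorsion K := QuotientGroup.mk' (torsion K)

theorem unitsModTorsionMk_surjective : Function.Surjective (unitsModTorsionMk (K := K)) :=
  QuotientGroup.mk'_surjective _

theorem unitsModTorsionMk_eq_one_iff {u : (𝓞 K)ˣ} : unitsModTorsionMk u = 1 ↔ u ∈ torsion K :=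
  QuotientGroup.eq_one_iff u

variable (k : Type*) [Field k] [Algebra k K]

/-- The relative norm on units. -/
noncomputable def unitsNorm : (𝓞 K)ˣ →* (𝓞 k)ˣ := Units.map (RingOfIntegers.norm k)

/-- The relative norm on units modulo torsion, as a `ℤ`-linear map. -/
noncomputable def normModTorsion :
    Additive (UnitsModTorsion K) →ₗ[ℤ] Additive (UnitsModTorsion k) :=
  AddMonoidHom.toIntLinearMap <| MonoidHom.toAdditive <|
    QuotientGroup.map (torsion K) (torsion k) (unitsNorm k) fun _ hx =>
      (CommGroup.mem_torsion _).mpr (MonoidHom.isOfFinOrder _ ((CommGroup.mem_torsion _).mp hx))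

theorem normModTorsion_mk (u : (𝓞 K)ˣ) :
    normModTorsion k (Additive.ofMul (unitsModTorsionMk u)) =
      Additive.ofMul (unitsModTorsionMk (unitsNorm k u)) :=
  rfl

theorem mk_mem_ker_normModTorsion_iff (u : (𝓞 K)ˣ) :
    Additive.ofMul (unitsModTorsionMk u) ∈ LinearMap.ker (normModTorsion (K := K) k) ↔
      unitsNorm k u ∈ torsion k := by
  rw [LinearMap.mem_ker, normModTorsion_mk, ← unitsModTorsionMk_eq_one_iff]
  rfl

variable [NumberField K]

/-- The unit group of the finite ring `𝓞 K / d` is finite. -/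
theorem exists_dvd_pow_sub_one (u : (𝓞 K)ˣ) {d : 𝓞 K} (hd : d ≠ 0) :
    ∃ n : ℕ, n ≠ 0 ∧ d ∣ (u : 𝓞 K) ^ n - 1 := by
  have : Finite (𝓞 K ⧸ Ideal.span {d}) :=
    Ideal.finiteQuotientOfFreeOfNeBot _ (by simpa using hd)
  obtain ⟨n, hn, h⟩ := isOfFinOrder_iff_pow_eq_one.mp
    (isOfFinOrder_of_finite (Units.map (Ideal.Quotient.mk (Ideal.span {d})).toMonoidHom u))
  refine ⟨n, hn.ne', ?_⟩
  rw [← Ideal.mem_span_singleton, ← Ideal.Quotient.eq, map_pow, map_one]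
  exact congrArg Units.val h

open scoped Classical in
theorem nrRealPlaces_eq_card : InfinitePlace.nrRealPlaces K = Nat.card (K →+* ℝ) := by
  rw [← InfinitePlace.card_real_embeddings, ← Nat.card_eq_fintype_card]
  refine Nat.card_congr
    { toFun := fun φ => φ.2.embedding
      invFun := fun φ => ⟨Complex.ofRealHom.comp φ, ?_⟩
      left_inv := ?_
      right_inv := ?_ }
  · rw [ComplexEmbedding.isReal_iff]
    ext x
    simp
  · intro φ
    ext x
    simp
  · intro φ
    ext x
    apply Complex.ofReal_injective
    simp

instance : Finite (K →+* ℝ) :=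
  Finite.of_injective (fun φ : K →+* ℝ => Complex.ofRealHom.comp φ) fun φ ψ h => by
    ext x
    exact Complex.ofReal_injective (congrArg (fun f : K →+* ℂ => f x) h)

instance : Module.Free ℤ (Additive (UnitsModTorsion K)) :=
  NumberField.Units.instFreeIntAdditiveQuotientUnitsRingOfIntegersSubgroupTorsion K

instance : Module.Finite ℤ (Additive (UnitsModTorsion K)) :=
  NumberField.Units.instFiniteIntAdditiveQuotientUnitsRingOfIntegersSubgroupTorsion K

variable (K) in
theorem finrank_unitsModTorsion :
    Module.finrank ℤ (Additive (UnitsModTorsion K)) = rank K :=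
  finrank_modTorsion K

variable [NumberField k]

/-- On units coming from `k` the norm is the power `[K : k]`, so its image has full rank;
rank-nullity gives the rest. -/
theorem finrank_ker_normModTorsion :
    Module.finrank ℤ (LinearMap.ker (normModTorsion (K := K) k)) + rank k = rank K := by
  have h1 := (LinearMap.ker (normModTorsion (K := K) k)).finrank_quotient_add_finrank
  rw [((normModTorsion (K := K) k).quotKerEquivRange).finrank_eq, finrank_unitsModTorsion] at h1
  have h2 : Module.finrank ℤ (LinearMap.range (normModTorsion (K := K) k)) = rank k := by
    rw [← finrank_unitsModTorsion k]
    refine finrank_eq_of_injective_of_torsion (Submodule.subtype _)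
      (Submodule.subtype_injective _) fun y => ?_
    obtain ⟨u, hu⟩ := unitsModTorsionMk_surjective (Additive.toMul y)
    have : Module.Finite k K := Module.Finite.of_restrictScalars_finite ℚ k K
    refine ⟨Module.finrank k K, Module.finrank_pos.ne', ?_⟩
    rw [Submodule.range_subtype]
    refine ⟨Additive.ofMul (unitsModTorsionMk (Units.map (algebraMap (𝓞 k) (𝓞 K)).toMonoidHom u)),
      ?_⟩
    have : unitsNorm k
        (Units.map (algebraMap (𝓞 k) (𝓞 K)).toMonoidHom u) = u ^ Module.finrank k K := by
      ext1
      exact RingOfIntegers.norm_algebraMap k (u : 𝓞 k)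
    rw [normModTorsion_mk, this, map_pow, hu]
    rfl
  omega

end Units

/-! ### The quadratic algebra `k[ω]` and eigenvalues of the centralizer -/

section CharAlgebra

variable {k : Type*} [Field k]

/-- The trace of `A ∈ SL(2, 𝓞 k)`. -/
def intTrace (A : SL(2, 𝓞 k)) : 𝓞 k := Matrix.trace (A : Matrix (Fin 2) (Fin 2) (𝓞 k))

/-- The quadratic `k`-algebra `k[ω]` with `ω ^ 2 = tr(A) ω - 1`. -/
abbrev CharAlgebra (A : SL(2, 𝓞 k)) : Type _ := QuadraticAlgebra k (-1) (intTrace A : k)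

/-- The matrix of `A`, with entries viewed in `k`. -/
def fieldMatrix (A : SL(2, 𝓞 k)) : Matrix (Fin 2) (Fin 2) k :=
  (A : Matrix (Fin 2) (Fin 2) (𝓞 k)).map (algebraMap (𝓞 k) k)

theorem fieldMatrix_apply (A : SL(2, 𝓞 k)) (i j : Fin 2) : fieldMatrix A i j = (A i j : k) := rfl

theorem fieldMatrix_mul (A B : SL(2, 𝓞 k)) :
    fieldMatrix (A * B) = fieldMatrix A * fieldMatrix B := by
  simp [fieldMatrix, Matrix.map_mul]

theorem fieldMatrix_one : fieldMatrix (1 : SL(2, 𝓞 k)) = 1 := by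
  simp [fieldMatrix]

theorem fieldMatrix_injective : Function.Injective (fieldMatrix (k := k)) := by
  intro A B h
  ext i j
  exact congrFun (congrFun h i) j

theorem intTrace_coe (A : SL(2, 𝓞 k)) : (intTrace A : k) = (A 0 0 : k) + (A 1 1 : k) := by
  simp [intTrace, Matrix.trace_fin_two]

theorem coe_det (A : SL(2, 𝓞 k)) :
    (A 0 0 : k) * (A 1 1 : k) - (A 0 1 : k) * (A 1 0 : k) = 1 := by
  have h := congrArg (algebraMap (𝓞 k) k) A.det_coe
  rw [Matrix.det_fin_two] at h
  simpa using h

variable (A : SL(2, 𝓞 k))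

/-- The `k`-algebra homomorphism `k[ω] → M₂(k)` sending `ω` to `A`. -/
noncomputable def toMatrixHom : CharAlgebra A →ₐ[k] Matrix (Fin 2) (Fin 2) k :=
  QuadraticAlgebra.lift ⟨fieldMatrix A, by
    have h := coe_det A
    ext i j
    fin_cases i <;> fin_cases j <;>
      simp [Matrix.mul_apply, fieldMatrix_apply, intTrace_coe] <;>
      first | linear_combination h | linear_combination -h | ring⟩

theorem toMatrixHom_apply (z : CharAlgebra A) :
    toMatrixHom A z = z.re • 1 + z.im • fieldMatrix A := rfl

theorem det_toMatrixHom (z : CharAlgebra A) : (toMatrixHom A z).det = z.norm := by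
  have h := coe_det A
  rw [toMatrixHom_apply, Matrix.det_fin_two, QuadraticAlgebra.norm_def]
  simp [fieldMatrix_apply, intTrace_coe]
  linear_combination z.im ^ 2 * h

theorem trace_toMatrixHom (z : CharAlgebra A) : (toMatrixHom A z).trace = z.trace := by
  rw [toMatrixHom_apply, Matrix.trace_fin_two, QuadraticAlgebra.trace_def]
  simp [fieldMatrix_apply, intTrace_coe]
  ring

variable {A}

theorem toMatrixHom_injective (hA : IsNonscalar (A : Matrix (Fin 2) (Fin 2) (𝓞 k))) :
    Function.Injective (toMatrixHom A) := by
  rw [injective_iff_map_eq_zero]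
  intro z hz
  rw [toMatrixHom_apply] at hz
  have e00 := congrFun (congrFun hz 0) 0
  have e01 := congrFun (congrFun hz 0) 1
  have e10 := congrFun (congrFun hz 1) 0
  have e11 := congrFun (congrFun hz 1) 1
  simp [fieldMatrix_apply] at e00 e01 e10 e11
  have him : z.im = 0 := by
    rcases hA with h | h | h
    · exact e01.resolve_right h
    · exact e10.resolve_right h
    · have h' : (A 0 0 : k) - (A 1 1 : k) ≠ 0 :=
        sub_ne_zero.mpr fun h' => h (NumberField.RingOfIntegers.ext h')
      exact (mul_eq_zero.mp
        (by linear_combination e00 - e11 : z.im * ((A 0 0 : k) - (A 1 1 : k)) = 0)).resolve_right h'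
  ext
  · simpa [him] using e00
  · exact him

theorem exists_toMatrixHom_eq (hA : IsNonscalar (A : Matrix (Fin 2) (Fin 2) (𝓞 k)))
    {M : SL(2, 𝓞 k)} (h : M * A = A * M) : ∃ z, toMatrixHom A z = fieldMatrix M := by
  obtain ⟨c, x, y, hc, hM⟩ := exists_smul_eq_of_commute (M := (M : Matrix (Fin 2) (Fin 2) _)) hA
    (congrArg Subtype.val h)
  have hc' : (c : k) ≠ 0 := fun h' => hc (NumberField.RingOfIntegers.ext h')
  refine ⟨⟨x / c, y / c⟩, ?_⟩
  rw [toMatrixHom_apply]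
  ext i j
  have e := congrArg (algebraMap (𝓞 k) k) (congrFun (congrFun hM i) j)
  fin_cases i <;> fin_cases j <;> simp [fieldMatrix_apply] at e ⊢ <;> field_simp <;>
    linear_combination -e

theorem mul_eq_mul_of_mem_centralizer (M : Subgroup.centralizer {A}) :
    (M : SL(2, 𝓞 k)) * A = A * M :=
  Subgroup.mem_centralizer_singleton_iff.mp M.2

/-- An element of `SL(2, 𝓞 k)` commuting with `A`, written in the form `x + y A`. -/
noncomputable def centralizerCoord (hA : IsNonscalar (A : Matrix (Fin 2) (Fin 2) (𝓞 k))) :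
    Subgroup.centralizer {A} →* CharAlgebra A where
  toFun M := (exists_toMatrixHom_eq hA (mul_eq_mul_of_mem_centralizer M)).choose
  map_one' := by
    refine toMatrixHom_injective hA ?_
    rw [(exists_toMatrixHom_eq hA (mul_eq_mul_of_mem_centralizer 1)).choose_spec, map_one]
    exact fieldMatrix_one
  map_mul' M N := by
    refine toMatrixHom_injective hA ?_
    rw [(exists_toMatrixHom_eq hA (mul_eq_mul_of_mem_centralizer (M * N))).choose_spec, map_mul,
      (exists_toMatrixHom_eq hA (mul_eq_mul_of_mem_centralizer M)).choose_spec,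
      (exists_toMatrixHom_eq hA (mul_eq_mul_of_mem_centralizer N)).choose_spec]
    exact fieldMatrix_mul _ _

theorem toMatrixHom_centralizerCoord (hA : IsNonscalar (A : Matrix (Fin 2) (Fin 2) (𝓞 k)))
    (M : Subgroup.centralizer {A}) :
    toMatrixHom A (centralizerCoord hA M) = fieldMatrix (M : SL(2, 𝓞 k)) :=
  (exists_toMatrixHom_eq hA (mul_eq_mul_of_mem_centralizer M)).choose_spec

theorem norm_centralizerCoord (hA : IsNonscalar (A : Matrix (Fin 2) (Fin 2) (𝓞 k)))
    (M : Subgroup.centralizer {A}) : (centralizerCoord hA M).norm = 1 := by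
  rw [← det_toMatrixHom, toMatrixHom_centralizerCoord, Matrix.det_fin_two]
  exact coe_det _

theorem trace_centralizerCoord (hA : IsNonscalar (A : Matrix (Fin 2) (Fin 2) (𝓞 k)))
    (M : Subgroup.centralizer {A}) :
    (centralizerCoord hA M).trace = (intTrace (M : SL(2, 𝓞 k)) : k) := by
  rw [← trace_toMatrixHom, toMatrixHom_centralizerCoord, Matrix.trace_fin_two, intTrace_coe]
  rfl

/-- Integral coordinates suffice for an integral matrix, though they are not necessary. This gives a
finite index part of the centralizer, enough for ranks. -/
theorem exists_centralizerCoord_eq (hA : IsNonscalar (A : Matrix (Fin 2) (Fin 2) (𝓞 k)))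
    (x y : 𝓞 k) (h : QuadraticAlgebra.norm (⟨x, y⟩ : CharAlgebra A) = 1) :
    ∃ M, centralizerCoord hA M = ⟨x, y⟩ := by
  let M₀ : Matrix (Fin 2) (Fin 2) (𝓞 k) := x • 1 + y • (A : Matrix (Fin 2) (Fin 2) (𝓞 k))
  have hM₀ : M₀.map (algebraMap (𝓞 k) k) = toMatrixHom A ⟨x, y⟩ := by
    rw [toMatrixHom_apply]
    ext i j
    change algebraMap (𝓞 k) k (x * (1 : Matrix (Fin 2) (Fin 2) (𝓞 k)) i j + y * A i j) =
      (x : k) * (1 : Matrix (Fin 2) (Fin 2) k) i j + (y : k) * (A i j : k)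
    fin_cases i <;> fin_cases j <;> simp
  have hdet : M₀.det = 1 := by
    apply NumberField.RingOfIntegers.ext
    have : algebraMap (𝓞 k) k M₀.det = (M₀.map (algebraMap (𝓞 k) k)).det :=
      RingHom.map_det _ _
    change algebraMap (𝓞 k) k M₀.det = _
    rw [this, hM₀, det_toMatrixHom, h]
    simp
  let M : SL(2, 𝓞 k) := ⟨M₀, hdet⟩
  have hM : M ∈ Subgroup.centralizer {A} := by
    rw [Subgroup.mem_centralizer_singleton_iff]
    apply Subtype.ext
    change M₀ * (A : Matrix (Fin 2) (Fin 2) (𝓞 k)) = (A : Matrix (Fin 2) (Fin 2) (𝓞 k)) * M₀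
    simp [M₀, add_mul, mul_add]
  refine ⟨⟨M, hM⟩, toMatrixHom_injective hA ?_⟩
  rw [toMatrixHom_centralizerCoord]
  exact hM₀

section Hom

variable {K : Type*} [Field K] [Algebra k K]

theorem map_omega_mul_self (ρ : CharAlgebra A →ₐ[k] K) :
    ρ QuadraticAlgebra.omega * ρ QuadraticAlgebra.omega =
      algebraMap k K (intTrace A : k) * ρ QuadraticAlgebra.omega - 1 := by
  rw [← map_mul, QuadraticAlgebra.omega_mul_omega_eq_add]
  simp [Algebra.smul_def]
  ring

theorem map_charAlgebra (ρ : CharAlgebra A →ₐ[k] K) (z : CharAlgebra A) :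
    ρ z = algebraMap k K z.re + algebraMap k K z.im * ρ QuadraticAlgebra.omega := by
  conv_lhs => rw [← QuadraticAlgebra.mk_eta z, QuadraticAlgebra.mk_eq_add_smul_omega]
  simp [Algebra.smul_def]

theorem two_mul_map_omega_sub_ne_zero (ρ : CharAlgebra A →ₐ[k] K) (ht : intTrace A ^ 2 ≠ 4) :
    2 * ρ QuadraticAlgebra.omega - algebraMap k K (intTrace A : k) ≠ 0 := by
  intro h
  have h1 := map_omega_mul_self ρ
  have h2 : algebraMap k K ((intTrace A : k) ^ 2 - 4) = 0 := by
    simp only [map_sub, map_pow, map_ofNat]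
    linear_combination (2 * ρ QuadraticAlgebra.omega - algebraMap k K (intTrace A : k)) * h
      - 4 * h1
  rw [map_eq_zero, sub_eq_zero] at h2
  exact ht (FaithfulSMul.algebraMap_injective (𝓞 k) k (by rw [map_pow, map_ofNat]; exact h2))

/-- In the split case `ρ` is not injective, so the norm is needed: norm 1 forces the conjugate
eigenvalue to be `ε⁻¹ = ε` too, and two equal eigenvalues kill the coefficient of `ω`. -/
theorem eq_algebraMap_of_map_eq (ρ : CharAlgebra A →ₐ[k] K) (ht : intTrace A ^ 2 ≠ 4)
    {z : CharAlgebra A} (hz : z.norm = 1) {ε : k} (hε : ε * ε = 1)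
    (h : ρ z = algebraMap k K ε) : z = algebraMap k _ ε := by
  have h1 := map_omega_mul_self ρ
  rw [map_charAlgebra] at h
  have hz' := congrArg (algebraMap k K) hz
  rw [QuadraticAlgebra.norm_def] at hz'
  have hε' := congrArg (algebraMap k K) hε
  simp only [map_sub, map_add, map_mul, map_neg, map_one] at hz' hε'
  set θ := ρ QuadraticAlgebra.omega
  set t := algebraMap k K (intTrace A : k)
  set x := algebraMap k K z.re
  set y := algebraMap k K z.im with hy
  set e := algebraMap k K ε
  have h2 : x + y * (t - θ) = e := by
    have : e * (x + y * (t - θ)) = 1 := by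
      rw [← h]
      linear_combination hz' - y * y * h1
    linear_combination e * this - (x + y * (t - θ)) * hε'
  have h3 : y * (2 * θ - t) = 0 := by linear_combination h - h2
  have h4 : y = 0 :=
    (mul_eq_zero.mp h3).resolve_right (two_mul_map_omega_sub_ne_zero ρ ht)
  have h5 : z.im = 0 := by rwa [hy, map_eq_zero] at h4
  have h6 : x = e := by rw [← h, h4]; ring
  ext
  · exact (algebraMap k K).injective h6
  · simpa using h5

theorem isIntegral_of_quadratic {w : K} (a : 𝓞 k)
    (h : w * w = algebraMap k K (a : k) * w - 1) : IsIntegral ℤ w := by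
  have h1 : IsIntegral (𝓞 k) w := by
    refine ⟨Polynomial.X ^ 2 - Polynomial.C a * Polynomial.X + 1, by monicity!, ?_⟩
    have : algebraMap (𝓞 k) K a = algebraMap k K (a : k) := rfl
    simp [this]
    linear_combination h
  exact isIntegral_trans w h1

theorem isIntegral_map_centralizerCoord
    (hA : IsNonscalar (A : Matrix (Fin 2) (Fin 2) (𝓞 k))) (ρ : CharAlgebra A →ₐ[k] K)
    (M : Subgroup.centralizer {A}) : IsIntegral ℤ (ρ (centralizerCoord hA M)) := by
  refine isIntegral_of_quadratic (intTrace (M : SL(2, 𝓞 k))) ?_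
  have h := QuadraticAlgebra.sq_eq_trace_smul_sub_norm (z := centralizerCoord hA M)
  rw [norm_centralizerCoord, trace_centralizerCoord] at h
  have h2 := congrArg ρ h
  simpa [sq, Algebra.smul_def] using h2

/-- The eigenvalue in `K` of a matrix commuting with `A`, with respect to the eigenvector of `A`
singled out by `ρ : k[ω] → K`. -/
noncomputable def eigenUnit (hA : IsNonscalar (A : Matrix (Fin 2) (Fin 2) (𝓞 k)))
    (ρ : CharAlgebra A →ₐ[k] K) : Subgroup.centralizer {A} →* (𝓞 K)ˣ :=
  (NumberField.RingOfIntegers.restrict_monoidHom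
    ((ρ : CharAlgebra A →* K).comp (centralizerCoord hA))
    (isIntegral_map_centralizerCoord hA ρ)).toHomUnits

theorem coe_eigenUnit (hA : IsNonscalar (A : Matrix (Fin 2) (Fin 2) (𝓞 k)))
    (ρ : CharAlgebra A →ₐ[k] K) (M : Subgroup.centralizer {A}) :
    ((eigenUnit hA ρ M : (𝓞 K)ˣ) : K) = ρ (centralizerCoord hA M) := rfl

theorem centralizerCoord_eq_algebraMap_iff
    (hA : IsNonscalar (A : Matrix (Fin 2) (Fin 2) (𝓞 k))) (M : Subgroup.centralizer {A}) :
    (centralizerCoord hA M = 1 ↔ (M : SL(2, 𝓞 k)) = 1) ∧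
      (centralizerCoord hA M = -1 ↔ (M : SL(2, 𝓞 k)) = -1) := by
  have hneg : fieldMatrix (-1 : SL(2, 𝓞 k)) = -1 := by
    ext i j
    fin_cases i <;> fin_cases j <;> simp [fieldMatrix_apply]
  constructor
  · rw [← (toMatrixHom_injective hA).eq_iff, toMatrixHom_centralizerCoord, map_one,
      ← fieldMatrix_one, fieldMatrix_injective.eq_iff]
  · rw [← (toMatrixHom_injective hA).eq_iff, toMatrixHom_centralizerCoord, map_neg, map_one,
      ← hneg, fieldMatrix_injective.eq_iff]

/-- The real embedding `φ` makes every root of unity in `K` equal to `±1`, so the kernel of the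
eigenvalue modulo torsion is exactly what `PSL` divides out. -/
theorem unitsModTorsionMk_eigenUnit_eq_one_iff
    (hA : IsNonscalar (A : Matrix (Fin 2) (Fin 2) (𝓞 k))) (ht : intTrace A ^ 2 ≠ 4)
    (ρ : CharAlgebra A →ₐ[k] K) (φ : K →+* ℝ) (M : Subgroup.centralizer {A}) :
    unitsModTorsionMk (eigenUnit hA ρ M) = 1 ↔
      (((M : SL(2, 𝓞 k)) : PSL(2, 𝓞 k)) = 1) := by
  rw [unitsModTorsionMk_eq_one_iff, psl_mk_eq_one_iff]
  have hc := centralizerCoord_eq_algebraMap_iff hA M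
  constructor
  · intro h
    rcases eq_one_or_neg_one_of_mem_torsion φ h with h1 | h1 <;> rw [coe_eigenUnit] at h1
    · left
      refine hc.1.mp ?_
      simpa using eq_algebraMap_of_map_eq ρ ht (norm_centralizerCoord hA M) (ε := 1) (by simp)
        (by simpa using h1)
    · right
      refine hc.2.mp ?_
      simpa using eq_algebraMap_of_map_eq ρ ht (norm_centralizerCoord hA M) (ε := -1) (by simp)
        (by simpa using h1)
  · intro h
    have hM : M ^ 2 = 1 := by
      apply Subtype.ext
      rcases h with h | h <;> simp [h]
    refine (CommGroup.mem_torsion _).mpr (isOfFinOrder_iff_pow_eq_one.mpr ⟨2, two_pos, ?_⟩)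
    rw [← map_pow, hM, map_one]

end Hom

end CharAlgebra

/-! ### Powers of units realized as eigenvalues -/

section UnitImage

open NumberField

variable {k : Type*} [Field k] [NumberField k] {A : SL(2, 𝓞 k)}

theorem exists_eigenUnit_eq_pow_of_split
    (hA : IsNonscalar (A : Matrix (Fin 2) (Fin 2) (𝓞 k))) (ht : intTrace A ^ 2 ≠ 4)
    (ρ : CharAlgebra A →ₐ[k] k) (u : (𝓞 k)ˣ) :
    ∃ n : ℕ, n ≠ 0 ∧ ∃ M, eigenUnit hA ρ M = u ^ n := by
  have h1 := map_omega_mul_self ρ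
  have hδ := two_mul_map_omega_sub_ne_zero ρ ht
  obtain ⟨θ, hθ⟩ : ∃ θ : 𝓞 k, (θ : k) = ρ QuadraticAlgebra.omega :=
    ⟨⟨_, isIntegral_of_quadratic (intTrace A) h1⟩, rfl⟩
  simp only [← hθ, Algebra.algebraMap_self, RingHom.id_apply] at h1 hδ
  have h1' : θ * θ = intTrace A * θ - 1 := RingOfIntegers.ext (by simpa using h1)
  have hδ' : 2 * θ - intTrace A ≠ 0 := fun h => hδ (by
    have := congrArg (algebraMap (𝓞 k) k) h
    rwa [map_sub, map_mul, map_ofNat, map_zero] at this)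
  obtain ⟨n, hn, w, hw⟩ := exists_dvd_pow_sub_one u hδ'
  set v : 𝓞 k := ((u ^ n : (𝓞 k)ˣ) : 𝓞 k) with hv
  set v' : 𝓞 k := (((u ^ n)⁻¹ : (𝓞 k)ˣ) : 𝓞 k) with hv'
  have hvv : v * v' = 1 := Units.mul_inv _
  have hw' : v - 1 = (2 * θ - intTrace A) * w := by rw [← hw, hv]; simp
  -- Chosen so that `y (2θ - t) = v - v⁻¹`: then `(v - y θ) + y ω` has eigenvalues `v` and `v⁻¹`.
  -- The congruence on `v` makes `y` integral.
  set y : 𝓞 k := v' * (v + 1) * w with hy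
  have hnorm : QuadraticAlgebra.norm (⟨(v - y * θ : 𝓞 k), y⟩ : CharAlgebra A) = 1 := by
    have : (v - y * θ) * (v - y * θ) + intTrace A * (v - y * θ) * y + y * y = 1 := by
      have hyd : y * (2 * θ - intTrace A) = v' * (v + 1) * (v - 1) := by rw [hw', hy]; ring
      linear_combination (-v) * hyd + (y * y) * h1' - (v ^ 2 - 1) * hvv
    rw [QuadraticAlgebra.norm_def]
    have h2 := congrArg (algebraMap (𝓞 k) k) this
    simp only [map_add, map_mul, map_one, map_sub] at h2 ⊢
    linear_combination h2
  obtain ⟨M, hM⟩ := exists_centralizerCoord_eq hA _ _ hnorm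
  refine ⟨n, hn, M, ?_⟩
  apply NumberField.Units.coe_injective
  change ((eigenUnit hA ρ M : (𝓞 k)ˣ) : k) = (v : k)
  rw [coe_eigenUnit, hM, map_charAlgebra, ← hθ]
  simp

variable {K : Type*} [Field K] [NumberField K] [Algebra k K]

omit [NumberField k] [NumberField K] in
theorem algebraNorm_map (ρ : CharAlgebra A ≃ₐ[k] K) (z : CharAlgebra A) :
    Algebra.norm k (ρ z) = z.norm := by
  rw [Algebra.norm_eq_of_algEquiv, Algebra.norm_apply, ← QuadraticAlgebra.det_toLinearMap_eq_norm]
  rfl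

omit [NumberField k] [NumberField K] in
theorem equiv_omega_mul_self (ρ : CharAlgebra A ≃ₐ[k] K) :
    ρ QuadraticAlgebra.omega * ρ QuadraticAlgebra.omega =
      algebraMap k K (intTrace A : k) * ρ QuadraticAlgebra.omega - 1 :=
  map_omega_mul_self (ρ : CharAlgebra A →ₐ[k] K)

omit [NumberField k] [NumberField K] in
theorem equiv_charAlgebra (ρ : CharAlgebra A ≃ₐ[k] K) (z : CharAlgebra A) :
    ρ z = algebraMap k K z.re + algebraMap k K z.im * ρ QuadraticAlgebra.omega :=
  map_charAlgebra (ρ : CharAlgebra A →ₐ[k] K) z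

/-- The order `𝓞 k[ω]` contains a fixed multiple of `𝓞 K`: the coordinates of `w` are recovered from
`w` and its conjugate by dividing by 2 and by the discriminant `t ^ 2 - 4`. -/
theorem exists_integral_multiple (ρ : CharAlgebra A ≃ₐ[k] K) (w : 𝓞 K) :
    ∃ x y : 𝓞 k, ρ ⟨(x : k), (y : k)⟩ =
      algebraMap k K ((2 * (intTrace A ^ 2 - 4) : 𝓞 k) : k) * (w : K) := by
  obtain ⟨z, hz⟩ := ρ.surjective (w : K)
  have h1 := equiv_omega_mul_self ρ
  have hρz := equiv_charAlgebra ρ z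
  set θ := ρ QuadraticAlgebra.omega with hθ
  set t : k := (intTrace A : k) with ht
  have hθint : IsIntegral ℤ θ := isIntegral_of_quadratic (intTrace A) h1
  have htint : IsIntegral ℤ (algebraMap k K t) := (intTrace A).2.algebraMap
  -- The conjugation of `K` over `k`, sending `θ` to `t - θ`.
  let κ : K →+* K := ((ρ : CharAlgebra A →+* K).comp (starRingEnd (CharAlgebra A))).comp
    (ρ.symm : K →+* CharAlgebra A)
  have hκw : κ (w : K) = algebraMap k K z.re + algebraMap k K z.im * (algebraMap k K t - θ) := by
    change ρ (star (ρ.symm (w : K))) = _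
    rw [← hz, ρ.symm_apply_apply]
    have := equiv_charAlgebra ρ (star z)
    rw [this]
    simp
    ring
  have hw : (w : K) = algebraMap k K z.re + algebraMap k K z.im * θ := by rw [← hz, hρz]
  have hwint : IsIntegral ℤ (w : K) := w.2
  have hκint : IsIntegral ℤ (κ (w : K)) := map_isIntegral_int κ hwint
  have h2int : IsIntegral ℤ (2 : K) := by
    simpa using isIntegral_algebraMap (R := ℤ) (A := K) (x := 2)
  have h4int : IsIntegral ℤ (4 : K) := by
    simpa using isIntegral_algebraMap (R := ℤ) (A := K) (x := 4)
  -- The difference of `w` and its conjugate is `z.im (2θ - t)`, and `(2θ - t) ^ 2 = t ^ 2 - 4`.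
  have hy : IsIntegral ℤ (algebraMap k K (z.im * (t ^ 2 - 4))) := by
    have : algebraMap k K (z.im * (t ^ 2 - 4)) =
        ((w : K) - κ (w : K)) * (2 * θ - algebraMap k K t) := by
      rw [hκw, hw]
      simp only [map_mul, map_sub, map_pow, map_ofNat]
      linear_combination (-4 * algebraMap k K z.im) * h1
    rw [this]
    exact (hwint.sub hκint).mul ((h2int.mul hθint).sub htint)
  -- The trace of `w` is `2 z.re + z.im t`.
  have hx : IsIntegral ℤ (algebraMap k K (2 * z.re * (t ^ 2 - 4))) := by
    have : algebraMap k K (2 * z.re * (t ^ 2 - 4)) =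
        ((w : K) + κ (w : K)) * ((algebraMap k K t) ^ 2 - 4)
          - algebraMap k K (z.im * (t ^ 2 - 4)) * algebraMap k K t := by
      rw [hκw, hw]
      simp only [map_mul, map_sub, map_pow, map_ofNat]
      ring
    rw [this]
    exact ((hwint.add hκint).mul ((htint.pow 2).sub h4int)).sub (hy.mul htint)
  rw [isIntegral_algebraMap_iff (algebraMap k K).injective] at hx hy
  obtain ⟨y₀, hy₀⟩ : ∃ y₀ : 𝓞 k, (y₀ : k) = z.im * (t ^ 2 - 4) := ⟨⟨_, hy⟩, rfl⟩
  refine ⟨⟨_, hx⟩, 2 * y₀, ?_⟩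
  have := equiv_charAlgebra ρ
    ⟨2 * z.re * (t ^ 2 - 4), 2 * (z.im * (t ^ 2 - 4))⟩
  have h3 : ((2 * y₀ : 𝓞 k) : k) = 2 * (z.im * (t ^ 2 - 4)) := by
    change algebraMap (𝓞 k) k _ = _
    rw [map_mul, map_ofNat]
    exact congrArg (2 * ·) hy₀
  have h4 : ((2 * (intTrace A ^ 2 - 4) : 𝓞 k) : k) = 2 * (t ^ 2 - 4) := by
    change algebraMap (𝓞 k) k _ = _
    rw [map_mul, map_ofNat, map_sub, map_pow, map_ofNat]
  rw [h3, h4]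
  refine this.trans ?_
  rw [hw]
  simp only [map_mul, map_sub, map_pow, map_ofNat, ← hθ]
  ring

/-- A power of `u` congruent to 1 modulo `2 (t ^ 2 - 4)` lies in `𝓞 k[ω]`, and its norm is still 1.
-/
theorem exists_eigenUnit_eq_pow_of_equiv
    (hA : IsNonscalar (A : Matrix (Fin 2) (Fin 2) (𝓞 k))) (ht : intTrace A ^ 2 ≠ 4)
    (ρ : CharAlgebra A ≃ₐ[k] K) (u : (𝓞 K)ˣ) (hu : unitsNorm k u = 1) :
    ∃ n : ℕ, n ≠ 0 ∧ ∃ M, eigenUnit hA (ρ : CharAlgebra A →ₐ[k] K) M = u ^ n := by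
  have hd : algebraMap (𝓞 k) (𝓞 K) (2 * (intTrace A ^ 2 - 4)) ≠ 0 := by
    rw [Ne, FaithfulSMul.algebraMap_eq_zero_iff]
    exact mul_ne_zero two_ne_zero (sub_ne_zero.mpr ht)
  obtain ⟨n, hn, w, hw⟩ := exists_dvd_pow_sub_one u hd
  obtain ⟨x, y, hxy⟩ := exists_integral_multiple ρ w
  have hval : ρ ⟨((1 + x : 𝓞 k) : k), (y : k)⟩ = ((u ^ n : (𝓞 K)ˣ) : K) := by
    have h1 : (⟨((1 + x : 𝓞 k) : k), (y : k)⟩ : CharAlgebra A) = 1 + ⟨(x : k), (y : k)⟩ := by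
      ext <;> simp [QuadraticAlgebra.re_one, QuadraticAlgebra.im_one]
    have h2 : ((u : 𝓞 K) : K) ^ n - 1 =
        algebraMap k K ((2 * (intTrace A ^ 2 - 4) : 𝓞 k) : k) * (w : K) := by
      have := congrArg (algebraMap (𝓞 K) K) hw
      rwa [map_sub, map_pow, map_one, map_mul] at this
    rw [h1, map_add, map_one, hxy]
    rw [NumberField.Units.coe_pow, ← h2]
    ring
  have hnorm : QuadraticAlgebra.norm (⟨((1 + x : 𝓞 k) : k), (y : k)⟩ : CharAlgebra A) = 1 := by
    rw [← algebraNorm_map ρ, hval]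
    have h1 : unitsNorm k (u ^ n) = 1 := by rw [map_pow, hu, one_pow]
    have h2 := congrArg (fun v : (𝓞 k)ˣ => ((v : 𝓞 k) : k)) h1
    exact h2
  obtain ⟨M, hM⟩ := exists_centralizerCoord_eq hA _ _ hnorm
  refine ⟨n, hn, M, ?_⟩
  apply NumberField.Units.coe_injective
  change ((eigenUnit hA (ρ : CharAlgebra A →ₐ[k] K) M : (𝓞 K)ˣ) : K) = _
  rw [coe_eigenUnit, hM]
  exact hval

end UnitImage

/-! ### Real places of `K` and the rank of its units -/

section Places

open NumberField

variable {k : Type*} [Field k] {A : SL(2, 𝓞 k)} {K : Type*} [Field K] [Algebra k K]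

/-- The ring homomorphism `k[ω] → ℝ` extending `σ : k → ℝ` and sending `ω` to a root `r` of
`x ^ 2 - σ(tr A) x + 1`. -/
noncomputable def extendHom (σ : k →+* ℝ) (r : ℝ) (hr : r * r = σ (intTrace A) * r - 1) :
    CharAlgebra A →+* ℝ where
  toFun z := σ z.re + σ z.im * r
  map_one' := by simp [QuadraticAlgebra.re_one, QuadraticAlgebra.im_one]
  map_zero' := by simp
  map_add' z w := by simp; ring
  map_mul' z w := by
    simp
    linear_combination (-σ z.im * σ w.im) * hr

/-- The roots `(τ ± √(τ² - 4)) / 2` of `x² - τ x + 1`. -/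
noncomputable def realRoot (τ : ℝ) (b : Bool) : ℝ :=
  (τ + (if b then 1 else -1) * √(τ ^ 2 - 4)) / 2

theorem realRoot_mul_self {τ : ℝ} (h : 4 < τ ^ 2) (b : Bool) :
    realRoot τ b * realRoot τ b = τ * realRoot τ b - 1 := by
  have := Real.sq_sqrt (sub_nonneg.mpr h.le)
  cases b <;> simp only [realRoot] <;> simp <;> linear_combination this / 4

/-- A real embedding of `k` extends to `K` only if `x ^ 2 - σ(t) x + 1` has a real root. The
discriminant is nonzero, so there are then two roots and two extensions. -/
theorem card_real_embeddings_of_equiv (ρ : CharAlgebra A ≃ₐ[k] K) (ht : intTrace A ^ 2 ≠ 4) :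
    Nat.card (K →+* ℝ) = 2 * Set.ncard {σ : k →+* ℝ | 4 < σ (intTrace A) ^ 2} := by
  let F : {σ : k →+* ℝ | 4 < σ (intTrace A) ^ 2} × Bool → (K →+* ℝ) := fun p =>
    (extendHom p.1.1 (realRoot (p.1.1 (intTrace A)) p.2)
      (realRoot_mul_self p.1.2 p.2)).comp (ρ.symm : K →+* CharAlgebra A)
  have hF : ∀ p z, F p (ρ z) = p.1.1 z.re + p.1.1 z.im * realRoot (p.1.1 (intTrace A)) p.2 := by
    intro p z
    change extendHom p.1.1 _ (realRoot_mul_self p.1.2 p.2) (ρ.symm (ρ z)) = _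
    rw [ρ.symm_apply_apply]
    rfl
  have hbij : Function.Bijective F := by
    constructor
    · rintro ⟨⟨σ, hσ⟩, b⟩ ⟨⟨τ, hτ⟩, c⟩ h
      have h1 : σ = τ := by
        ext x
        have := congrArg (fun f : K →+* ℝ => f (ρ ⟨x, 0⟩)) h
        simpa [hF] using this
      subst h1
      have h2 := congrArg (fun f : K →+* ℝ => f (ρ ⟨0, 1⟩)) h
      have h3 : 0 < √(σ (intTrace A) ^ 2 - 4) := Real.sqrt_pos.mpr (sub_pos.mpr hσ)
      simp only [hF, map_zero, map_one, realRoot] at h2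
      have h4 : b = c := by
        cases b <;> cases c <;> simp at h2 ⊢ <;> linarith
      rw [h4]
    · intro φ
      have h1 := congrArg φ (equiv_omega_mul_self ρ)
      simp only [map_mul, map_sub, map_one] at h1
      set r := φ (ρ QuadraticAlgebra.omega) with hr
      set σ : k →+* ℝ := φ.comp (algebraMap k K) with hσ
      have h2 : r * r = σ (intTrace A) * r - 1 := h1
      have h3 : (2 * r - σ (intTrace A)) ^ 2 = σ (intTrace A) ^ 2 - 4 := by
        linear_combination 4 * h2
      have h4 : σ (intTrace A) ^ 2 ≠ 4 := by
        intro h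
        apply ht
        apply FaithfulSMul.algebraMap_injective (𝓞 k) k
        apply σ.injective
        rw [map_pow, map_pow, map_ofNat, map_ofNat]
        exact h
      have h5 : 4 < σ (intTrace A) ^ 2 := by
        have := sq_nonneg (2 * r - σ (intTrace A))
        exact lt_of_le_of_ne (by linarith) h4.symm
      have hs := Real.sq_sqrt (sub_nonneg.mpr h5.le)
      have h6 : ∃ b, r = realRoot (σ (intTrace A)) b := by
        rcases sq_eq_sq_iff_eq_or_eq_neg.mp (h3.trans hs.symm) with h | h
        · exact ⟨true, by simp [realRoot]; linarith⟩
        · exact ⟨false, by simp [realRoot]; linarith⟩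
      obtain ⟨b, hb⟩ := h6
      refine ⟨(⟨σ, h5⟩, b), ?_⟩
      ext x
      obtain ⟨z, rfl⟩ := ρ.surjective x
      have hz := equiv_charAlgebra ρ z
      rw [hF, hz, map_add, map_mul, ← hr, hb]
      rfl
  rw [← Nat.card_congr (Equiv.ofBijective F hbij), Nat.card_prod, Nat.card_coe_set_eq]
  simp [mul_comm]

variable [NumberField k]

theorem rank_add_of_equiv [NumberField K] [IsTotallyReal k] (ρ : CharAlgebra A ≃ₐ[k] K)
    (ht : intTrace A ^ 2 ≠ 4) :
    Units.rank K = Set.ncard {σ : k →+* ℝ | 4 < σ (intTrace A) ^ 2} + Units.rank k := by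
  have h1 := InfinitePlace.card_add_two_mul_card_eq_rank K
  have h2 := InfinitePlace.card_eq_nrRealPlaces_add_nrComplexPlaces K
  have h3 := InfinitePlace.card_eq_nrRealPlaces_add_nrComplexPlaces k
  have h4 := IsTotallyReal.nrComplexPlaces_eq_zero k
  have h5 := IsTotallyReal.finrank k
  have h6 : Module.finrank ℚ k * Module.finrank k K = Module.finrank ℚ K :=
    Module.finrank_mul_finrank ℚ k K
  have h7 : Module.finrank k K = 2 := by
    rw [← ρ.toLinearEquiv.finrank_eq]
    exact QuadraticAlgebra.finrank_eq_two _ _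
  rw [nrRealPlaces_eq_card, card_real_embeddings_of_equiv ρ ht] at h1 h2
  -- Keeps the truncated subtraction in the rank of `k` exact.
  have h8 : 0 < Fintype.card (InfinitePlace k) := Fintype.card_pos
  rw [Units.rank, Units.rank]
  rw [h7] at h6
  omega

theorem rank_eq_of_isTotallyReal [IsTotallyReal k] :
    Units.rank k = Module.finrank ℚ k - 1 := by
  rw [Units.rank, InfinitePlace.card_eq_nrRealPlaces_add_nrComplexPlaces,
    IsTotallyReal.nrComplexPlaces_eq_zero, IsTotallyReal.finrank, add_zero]

end Places

/-! ### Hyperbolic components, fixed points and roots in `k` -/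

section Components

variable {k : Type*} [Field k]

theorem trSq_hilbertEmbedding (A : SL(2, 𝓞 k)) (σ : k →+* ℝ) :
    trSq (hilbertEmbedding (A : PSL(2, 𝓞 k)) σ) = σ (intTrace A) ^ 2 := by
  change Matrix.trace ((A : Matrix (Fin 2) (Fin 2) (𝓞 k)).map
    (σ.comp (algebraMap (𝓞 k) k))) ^ 2 = _
  rw [Matrix.trace_fin_two, intTrace_coe]
  simp

theorem numHyperbolicComponents_mk (A : SL(2, 𝓞 k)) :
    numHyperbolicComponents (A : PSL(2, 𝓞 k)) =
      Set.ncard {σ : k →+* ℝ | 4 < σ (intTrace A) ^ 2} := by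
  simp only [numHyperbolicComponents, IsHyperbolic, trSq_hilbertEmbedding]

theorem boundaryAction_hilbertEmbedding (A : SL(2, 𝓞 k)) (σ : k →+* ℝ) (x : OnePoint ℝ) :
    boundaryAction (hilbertEmbedding (A : PSL(2, 𝓞 k)) σ) x =
      Matrix.SpecialLinearGroup.toGL
        (Matrix.SpecialLinearGroup.map (σ.comp (algebraMap (𝓞 k) k)) A) • x := rfl

theorem boundaryAction_infty_iff (A : SL(2, 𝓞 k)) (σ : k →+* ℝ) :
    boundaryAction (hilbertEmbedding (A : PSL(2, 𝓞 k)) σ) OnePoint.infty = OnePoint.infty ↔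
      A 1 0 = 0 := by
  rw [boundaryAction_hilbertEmbedding, OnePoint.smul_infty_eq_self_iff]
  change σ (A 1 0 : k) = 0 ↔ _
  rw [map_eq_zero]
  exact ⟨fun h => NumberField.RingOfIntegers.ext (by simpa using h), fun h => by simp [h]⟩

theorem boundaryAction_coe_iff (A : SL(2, 𝓞 k)) (σ : k →+* ℝ) (x : ℝ) :
    boundaryAction (hilbertEmbedding (A : PSL(2, 𝓞 k)) σ) (x : OnePoint ℝ) = x ↔
      σ (A 1 0) * x ^ 2 + (σ (A 1 1) - σ (A 0 0)) * x - σ (A 0 1) = 0 := by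
  rw [boundaryAction_hilbertEmbedding,
    ← Matrix.GeneralLinearGroup.fixpointPolynomial_aeval_eq_zero_iff]
  simp [Matrix.GeneralLinearGroup.fixpointPolynomial]

theorem intTrace_sq_ne_four {A : SL(2, 𝓞 k)} {σ : k →+* ℝ} (h : 4 < σ (intTrace A) ^ 2) :
    intTrace A ^ 2 ≠ 4 := by
  intro h'
  have h1 := congrArg (algebraMap (𝓞 k) k) h'
  rw [map_pow, map_ofNat] at h1
  have h2 := congrArg σ h1
  rw [map_pow, map_ofNat] at h2
  exact h.ne' h2

theorem intTrace_ne_zero {A : SL(2, 𝓞 k)} {σ : k →+* ℝ} (h : 4 < σ (intTrace A) ^ 2) :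
    intTrace A ≠ 0 := by
  intro h'
  rw [h'] at h
  simp at h
  linarith

theorem isNonscalar_of_intTrace {A : SL(2, 𝓞 k)} (h : intTrace A ^ 2 ≠ 4) :
    IsNonscalar (A : Matrix (Fin 2) (Fin 2) (𝓞 k)) := by
  refine isNonscalar_of_ne ?_ ?_ <;> rintro rfl <;> apply h <;>
    simp [intTrace] <;> norm_num

/-- A relation would make a real eigenvalue `r` at the hyperbolic place satisfy `|r| = 1`; then `r ^
2 = 1` and `σ(t) ^ 2 = 4`. -/
theorem eq_zero_of_zpow_eq_one {A : SL(2, 𝓞 k)} {σ : k →+* ℝ} (h : 4 < σ (intTrace A) ^ 2)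
    (a : ℤ) (ha : (A : PSL(2, 𝓞 k)) ^ a = 1) : a = 0 := by
  by_contra hne
  have hn : a.natAbs ≠ 0 := Int.natAbs_ne_zero.mpr hne
  have h1 : (A : PSL(2, 𝓞 k)) ^ a.natAbs = 1 := by
    rcases Int.natAbs_eq a with h' | h' <;> rw [h'] at ha
    · simpa using ha
    · simpa using ha
  set n := a.natAbs
  have hA := isNonscalar_of_intTrace (intTrace_sq_ne_four h)
  let M : Subgroup.centralizer {A} := ⟨A, Subgroup.mem_centralizer_singleton_iff.mpr rfl⟩
  have hM : centralizerCoord hA M = QuadraticAlgebra.omega := by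
    apply toMatrixHom_injective hA
    rw [toMatrixHom_centralizerCoord, toMatrixHom_apply]
    simp [M]
  have h2 : (centralizerCoord hA M) ^ n = 1 ∨ (centralizerCoord hA M) ^ n = -1 := by
    rw [← map_pow, (centralizerCoord_eq_algebraMap_iff hA _).1,
      (centralizerCoord_eq_algebraMap_iff hA _).2]
    exact psl_mk_eq_one_iff.mp h1
  rw [hM] at h2
  have hr := realRoot_mul_self h true
  set r := realRoot (σ (intTrace A)) true
  have h3 : extendHom σ r hr QuadraticAlgebra.omega = r := by
    change σ 0 + σ 1 * r = r
    simp
  have h4 : r ^ n = 1 ∨ r ^ n = -1 := by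
    rcases h2 with h2 | h2
    · left; rw [← h3, ← map_pow, h2, map_one]
    · right; rw [← h3, ← map_pow, h2, map_neg, map_one]
  have h5 : |r| ^ n = 1 := by
    rw [← abs_pow]
    rcases h4 with h4 | h4 <;> simp [h4]
  have h6 : |r| = 1 := (pow_eq_one_iff_of_nonneg (abs_nonneg r) hn).mp h5
  have h7 : r * r = 1 := by rw [← abs_mul_abs_self, h6, one_mul]
  have h8 : σ (intTrace A) ^ 2 = 4 := by
    have : σ (intTrace A) * r = 2 := by linarith
    linear_combination (σ (intTrace A) * r + 2) * this - σ (intTrace A) ^ 2 * h7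
  exact h.ne' h8

/-- A parabolic element has one fixed point, a double root of a quadratic over `k` and so rational
over `k`, or infinity. As `A` fixes it, `A` has an eigenvector and an eigenvalue over `k`. A single
place suffices. -/
theorem exists_root_of_isHyperbolicParabolic {A : SL(2, 𝓞 k)} (σ : k →+* ℝ)
    (h : IsHyperbolicParabolic (A : PSL(2, 𝓞 k))) :
    ∃ θ : k, θ * θ = (intTrace A : k) * θ - 1 := by
  obtain ⟨-, x, hAx, β, hβ, hβx⟩ := h
  obtain ⟨B, rfl⟩ := QuotientGroup.mk_surjective β
  have hA := hAx σ
  have hB := hβx σ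
  have hdA := coe_det A
  have hdB := coe_det B
  rw [intTrace_coe]
  induction hx : x σ using OnePoint.rec with
  | infty =>
    rw [hx, boundaryAction_infty_iff] at hA
    refine ⟨A 0 0, ?_⟩
    rw [hA] at hdA
    simp only [map_zero, mul_zero, sub_zero] at hdA
    linear_combination -hdA
  | coe x =>
    rw [hx, boundaryAction_coe_iff] at hA hB
    have hB1 : B ≠ 1 ∧ B ≠ -1 := by
      rw [← not_or, ← psl_mk_eq_one_iff]
      intro h
      apply (hβ σ).1
      rw [h, map_one]
      rfl
    have htr : σ ((B 0 0 : k) + (B 1 1 : k)) ^ 2 = 4 := by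
      rw [← intTrace_coe, ← trSq_hilbertEmbedding]
      exact (hβ σ).2
    have hdBσ := congrArg σ hdB
    simp only [map_add, map_sub, map_mul, map_one] at htr hdBσ
    -- A parabolic matrix with zero lower left entry fixes only infinity, whereas `x` is finite.
    have hc : (B 1 0 : k) ≠ 0 := by
      intro hc
      simp only [hc, map_zero, mul_zero, zero_mul, sub_zero, zero_add] at hdBσ hB
      have h1 : σ (B 1 1) - σ (B 0 0) = 0 := by
        have : (σ (B 1 1) - σ (B 0 0)) ^ 2 = 0 := by linear_combination htr - 4 * hdBσ
        exact pow_eq_zero_iff two_ne_zero |>.mp this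
      rw [h1, zero_mul, zero_sub, neg_eq_zero, map_eq_zero] at hB
      rw [sub_eq_zero] at h1
      rcases isNonscalar_of_ne hB1.1 hB1.2 with h2 | h2 | h2
      · exact h2 (NumberField.RingOfIntegers.ext (by simpa using hB))
      · exact h2 (NumberField.RingOfIntegers.ext (by simpa using hc))
      · exact h2 (NumberField.RingOfIntegers.ext (σ.injective h1.symm))
    have hcσ : σ (B 1 0) ≠ 0 := by rwa [Ne, map_eq_zero]
    set ξ : k := ((B 0 0 : k) - (B 1 1 : k)) / (2 * (B 1 0 : k)) with hξ
    have hxξ : x = σ ξ := by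
      have h1 : (2 * σ (B 1 0) * x + (σ (B 1 1) - σ (B 0 0))) ^ 2 = 0 := by
        linear_combination htr - 4 * hdBσ + 4 * σ (B 1 0) * hB
      have h2 := pow_eq_zero_iff two_ne_zero |>.mp h1
      simp only [hξ, map_div₀, map_sub, map_mul, map_ofNat]
      field_simp
      linear_combination h2
    rw [hxξ] at hA
    have hA' : (A 1 0 : k) * ξ ^ 2 + ((A 1 1 : k) - (A 0 0 : k)) * ξ - (A 0 1 : k) = 0 := by
      apply σ.injective
      simpa using hA
    refine ⟨(A 1 0 : k) * ξ + (A 1 1 : k), ?_⟩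
    linear_combination (A 1 0 : k) * hA' - hdA

/-- A root in `k` makes `t ^ 2 - 4` a nonzero square in `k`, hence positive at every real embedding.
-/
theorem isTotallyHyperbolic_of_root {A : SL(2, 𝓞 k)} (ht : intTrace A ^ 2 ≠ 4) {θ : k}
    (hθ : θ * θ = (intTrace A : k) * θ - 1) : IsTotallyHyperbolic (A : PSL(2, 𝓞 k)) := by
  intro σ
  rw [IsHyperbolic, trSq_hilbertEmbedding]
  have h1 := congrArg σ hθ
  simp only [map_sub, map_mul, map_one] at h1
  have h2 : (2 * σ θ - σ (intTrace A)) ^ 2 = σ (intTrace A) ^ 2 - 4 := by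
    linear_combination 4 * h1
  have h4 : σ (intTrace A) ^ 2 ≠ 4 := by
    intro h
    apply ht
    apply FaithfulSMul.algebraMap_injective (𝓞 k) k
    apply σ.injective
    rw [map_pow, map_pow, map_ofNat, map_ofNat]
    exact h
  have := sq_nonneg (2 * σ θ - σ (intTrace A))
  exact lt_of_le_of_ne (by linarith) h4.symm

theorem isTotallyParabolic_of_trace {B : SL(2, 𝓞 k)} (ht : intTrace B = 2)
    (hB : IsNonscalar (B : Matrix (Fin 2) (Fin 2) (𝓞 k))) :
    IsTotallyParabolic (B : PSL(2, 𝓞 k)) := by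
  intro σ
  refine ⟨fun h => ?_, ?_⟩
  · have hinj : Function.Injective (σ.comp (algebraMap (𝓞 k) k)) :=
      σ.injective.comp (FaithfulSMul.algebraMap_injective (𝓞 k) k)
    have h1 : ((Matrix.SpecialLinearGroup.map (σ.comp (algebraMap (𝓞 k) k)) B : SL(2, ℝ)) :
      PSL(2, ℝ)) = 1 := h
    rw [psl_mk_eq_one_iff] at h1
    have h2 : ∀ i j, σ (B i j) = (Matrix.SpecialLinearGroup.map
      (σ.comp (algebraMap (𝓞 k) k)) B : SL(2, ℝ)) i j := fun _ _ => rfl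
    rcases hB with hB | hB | hB <;> apply hB <;> apply hinj <;>
      simp only [RingHom.comp_apply, map_zero] <;> rcases h1 with h1 | h1 <;> simp [h2, h1]
  · rw [trSq_hilbertEmbedding, ht]
    have h2 : ((2 : 𝓞 k) : k) = 2 := map_ofNat (algebraMap (𝓞 k) k) 2
    rw [h2, map_ofNat]
    norm_num

theorem isHyperbolicParabolic_of_root {A : SL(2, 𝓞 k)} (ht : intTrace A ^ 2 ≠ 4) {θ : k}
    (hθ : θ * θ = (intTrace A : k) * θ - 1) : IsHyperbolicParabolic (A : PSL(2, 𝓞 k)) := by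
  refine ⟨isTotallyHyperbolic_of_root ht hθ, ?_⟩
  obtain ⟨θ, rfl⟩ : ∃ θ' : 𝓞 k, (θ' : k) = θ :=
    ⟨⟨θ, isIntegral_of_quadratic (intTrace A) hθ⟩, rfl⟩
  have hdA := coe_det A
  rw [intTrace_coe] at hθ
  by_cases hc : A 1 0 = 0
  · let B : SL(2, 𝓞 k) := ⟨!![1, 1; 0, 1], by simp⟩
    have hB01 : B 0 1 = 1 := rfl
    refine ⟨fun _ => OnePoint.infty, fun σ => (boundaryAction_infty_iff A σ).mpr hc, B,
      isTotallyParabolic_of_trace ?_ (Or.inl (by simp [hB01])),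
      fun σ => (boundaryAction_infty_iff B σ).mpr rfl⟩
    simp [intTrace, B, Matrix.trace_fin_two]
    norm_num
  · have hc' : (A 1 0 : k) ≠ 0 := fun h => hc (NumberField.RingOfIntegers.ext (by simpa using h))
    let e : 𝓞 k := θ - A 1 1
    let c : 𝓞 k := A 1 0
    -- The eigenvector of `A` for `θ` is `(e, c)`, with fixed point `e / c`. The matrix `B` is `1`
    -- plus a nilpotent integral matrix killing this vector.
    let B : SL(2, 𝓞 k) := ⟨!![1 + e * c, -e ^ 2; c ^ 2, 1 - e * c], by
      rw [Matrix.det_fin_two_of]; ring⟩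
    have hB10 : B 1 0 = c ^ 2 := rfl
    have he : (e : k) = (θ : k) - (A 1 1 : k) := by simp [e]
    set ξ : k := (e : k) / (A 1 0 : k) with hξ
    have hξc : (A 1 0 : k) * ξ = e := by rw [hξ]; field_simp
    refine ⟨fun σ => (σ ξ : ℝ), fun σ => (boundaryAction_coe_iff A σ _).mpr ?_, B,
      isTotallyParabolic_of_trace ?_ (Or.inr (Or.inl (by rw [hB10]; exact pow_ne_zero 2 hc))),
      fun σ => (boundaryAction_coe_iff B σ _).mpr ?_⟩
    · have : (A 1 0 : k) * ξ ^ 2 + ((A 1 1 : k) - (A 0 0 : k)) * ξ - (A 0 1 : k) = 0 := by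
        apply mul_left_cancel₀ hc'
        rw [mul_zero]
        have h3 : (A 1 0 : k) * ((A 1 0 : k) * ξ ^ 2 + ((A 1 1 : k) - (A 0 0 : k)) * ξ -
            (A 0 1 : k)) = ((A 1 0 : k) * ξ) ^ 2 + ((A 1 1 : k) - (A 0 0 : k)) * ((A 1 0 : k) * ξ)
            - (A 0 1 : k) * (A 1 0 : k) := by ring
        rw [h3, hξc, he]
        linear_combination hθ + hdA
      simpa using congrArg σ this
    · have : (1 + e * c) + (1 - e * c) = (2 : 𝓞 k) := by ring
      simpa [intTrace, B, Matrix.trace_fin_two] using this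
    · have : ((c ^ 2 : 𝓞 k) : k) * ξ ^ 2 + (((1 - e * c : 𝓞 k) : k) - ((1 + e * c : 𝓞 k) : k)) * ξ
          - ((-e ^ 2 : 𝓞 k) : k) = 0 := by
        simp only [map_pow, map_sub, map_add, map_mul, map_one, map_neg]
        change (A 1 0 : k) ^ 2 * ξ ^ 2 + (1 - (e : k) * (A 1 0 : k) - (1 + (e : k) * (A 1 0 : k)))
          * ξ - -(e : k) ^ 2 = 0
        linear_combination ((A 1 0 : k) * ξ - e) * hξc
      have h4 := congrArg σ this
      rw [map_zero, map_sub, map_add, map_mul, map_mul, map_sub, map_pow] at h4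
      exact h4

end Components

/-! ### The structure of the centralizer -/

section Centralizer

open NumberField

variable {k : Type*} [Field k] [NumberField k] {A : SL(2, 𝓞 k)}

theorem centralizer_equiv_freeAb {K : Type*} [Field K] [NumberField K] [Algebra k K]
    (hA : IsNonscalar (A : Matrix (Fin 2) (Fin 2) (𝓞 k))) (ht : intTrace A ^ 2 ≠ 4)
    (ht0 : intTrace A ≠ 0) (ρ : CharAlgebra A →ₐ[k] K) (φ : K →+* ℝ)
    (L : Submodule ℤ (Additive (UnitsModTorsion K)))
    (h1 : ∀ M, Additive.ofMul (unitsModTorsionMk (eigenUnit hA ρ M)) ∈ L)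
    (h2 : ∀ u : (𝓞 K)ˣ, Additive.ofMul (unitsModTorsionMk u) ∈ L →
      ∃ n : ℕ, n ≠ 0 ∧ ∃ M, eigenUnit hA ρ M = u ^ n) :
    Nonempty (Subgroup.centralizer {(A : PSL(2, 𝓞 k))} ≃* FreeAb (Module.finrank ℤ L)) := by
  have hiff := fun g : SL(2, 𝓞 k) =>
    mem_centralizer_iff_commute_lift (A := A) (g := g) two_ne_zero ht0
  let q : Subgroup.centralizer {A} →* Subgroup.centralizer {(A : PSL(2, 𝓞 k))} :=
    ((QuotientGroup.mk' (Subgroup.center (SL(2, 𝓞 k)))).comp (Subgroup.subtype _)).codRestrict _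
      fun M => (hiff M).mpr (mul_eq_mul_of_mem_centralizer M)
  refine nonempty_equiv_freeAb_of_surjective q (unitsModTorsionMk.comp (eigenUnit hA ρ)) ?_ ?_ L
    h1 ?_
  · rintro ⟨g, hg⟩
    obtain ⟨M, rfl⟩ := QuotientGroup.mk_surjective g
    exact ⟨⟨M, Subgroup.mem_centralizer_singleton_iff.mpr ((hiff M).mp hg)⟩, rfl⟩
  · intro M
    refine (unitsModTorsionMk_eigenUnit_eq_one_iff hA ht ρ φ M).trans ?_
    exact (Subtype.ext_iff (a1 := q M) (a2 := 1)).symm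
  · intro y hy
    obtain ⟨u, hu⟩ := unitsModTorsionMk_surjective (Additive.toMul y)
    obtain rfl : y = Additive.ofMul (unitsModTorsionMk u) := by rw [hu]; rfl
    obtain ⟨n, hn, M, hM⟩ := h2 u hy
    refine ⟨n, hn, M, ?_⟩
    rw [MonoidHom.comp_apply, hM, map_pow]
    rfl

theorem centralizer_equiv_of_split [IsTotallyReal k] (ht : intTrace A ^ 2 ≠ 4)
    (ht0 : intTrace A ≠ 0) (φ : k →+* ℝ) {θ : k} (hθ : θ * θ = (intTrace A : k) * θ - 1) :
    Nonempty (Subgroup.centralizer {(A : PSL(2, 𝓞 k))} ≃* FreeAb (Module.finrank ℚ k - 1)) := by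
  have hA := isNonscalar_of_intTrace ht
  let ρ : CharAlgebra A →ₐ[k] k := QuadraticAlgebra.lift ⟨θ, by
    simp only [smul_eq_mul]
    linear_combination hθ⟩
  have h := centralizer_equiv_freeAb hA ht ht0 ρ φ ⊤ (fun _ => Submodule.mem_top)
    (fun u _ => exists_eigenUnit_eq_pow_of_split hA ht ρ u)
  rwa [finrank_top, finrank_unitsModTorsion, rank_eq_of_isTotallyReal] at h

theorem centralizer_equiv_of_equiv [IsTotallyReal k] {K : Type*} [Field K] [NumberField K]
    [Algebra k K] (ρ : CharAlgebra A ≃ₐ[k] K) {σ : k →+* ℝ} (hσ : 4 < σ (intTrace A) ^ 2) :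
    Nonempty (Subgroup.centralizer {(A : PSL(2, 𝓞 k))} ≃*
      FreeAb (numHyperbolicComponents (A : PSL(2, 𝓞 k)))) := by
  have ht := intTrace_sq_ne_four hσ
  have hA := isNonscalar_of_intTrace ht
  have h := centralizer_equiv_freeAb hA ht (intTrace_ne_zero hσ) (ρ : CharAlgebra A →ₐ[k] K)
    ((extendHom σ _ (realRoot_mul_self hσ true)).comp (ρ.symm : K →+* CharAlgebra A))
    (LinearMap.ker (normModTorsion k)) ?_ ?_
  · have h1 := finrank_ker_normModTorsion (K := K) k
    have h2 := rank_add_of_equiv ρ ht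
    rw [← numHyperbolicComponents_mk] at h2
    rwa [show Module.finrank ℤ (LinearMap.ker (normModTorsion (K := K) k)) =
      numHyperbolicComponents (A : PSL(2, 𝓞 k)) by omega] at h
  · intro M
    rw [mk_mem_ker_normModTorsion_iff]
    have : unitsNorm k (eigenUnit hA (ρ : CharAlgebra A →ₐ[k] K) M) = 1 := by
      apply NumberField.Units.coe_injective
      change Algebra.norm k (ρ (centralizerCoord hA M)) = 1
      rw [algebraNorm_map, norm_centralizerCoord]
    rw [this]
    exact one_mem _
  · intro u hu
    -- The norm of `u` is only known to be torsion; a further power makes it 1.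
    rw [mk_mem_ker_normModTorsion_iff] at hu
    obtain ⟨e, he, heu⟩ := isOfFinOrder_iff_pow_eq_one.mp ((CommGroup.mem_torsion _).mp hu)
    rw [← map_pow] at heu
    obtain ⟨n, hn, M, hM⟩ := exists_eigenUnit_eq_pow_of_equiv hA ht ρ (u ^ e) heu
    exact ⟨e * n, mul_ne_zero he.ne' hn, M, by rw [hM, pow_mul]⟩

theorem centralizer_equiv_of_irreducible [IsTotallyReal k] {σ : k →+* ℝ}
    (hσ : 4 < σ (intTrace A) ^ 2) (hθ : ¬ ∃ θ : k, θ * θ = (intTrace A : k) * θ - 1) :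
    Nonempty (Subgroup.centralizer {(A : PSL(2, 𝓞 k))} ≃*
      FreeAb (numHyperbolicComponents (A : PSL(2, 𝓞 k)))) := by
  -- Irreducibility is what makes `k[ω]` itself a field.
  have : Fact (∀ r : k, r ^ 2 ≠ -1 + (intTrace A : k) * r) :=
    ⟨fun r hr => hθ ⟨r, by linear_combination hr⟩⟩
  have : NumberField (CharAlgebra A) := NumberField.of_module_finite k (CharAlgebra A)
  exact centralizer_equiv_of_equiv (K := CharAlgebra A) AlgEquiv.refl hσ

end Centralizer

end HilbertModular

theorem proposition4p6 (k : Type*) [Field k] [NumberField k] [NumberField.IsTotallyReal k]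
    (α : PSL(2, 𝓞 k)) (m : ℕ) (hm : numHyperbolicComponents α = m) (hm1 : 1 ≤ m) :
    Infinite (Subgroup.zpowers α) ∧
    commensurator (Subgroup.zpowers α) =
      Subgroup.normalizer (Subgroup.zpowers α : Set PSL(2, 𝓞 k)) ∧
    (¬ IsHyperbolicParabolic α →
      Nonempty (Subgroup.normalizer (Subgroup.zpowers α : Set PSL(2, 𝓞 k)) ≃* FreeAb m) ∨
      Nonempty (Subgroup.normalizer (Subgroup.zpowers α : Set PSL(2, 𝓞 k)) ≃*
        FreeAbSemidirect m)) ∧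
    (IsHyperbolicParabolic α →
      Nonempty (Subgroup.normalizer (Subgroup.zpowers α : Set PSL(2, 𝓞 k)) ≃*
        FreeAb (Module.finrank ℚ k - 1)) ∨
      Nonempty (Subgroup.normalizer (Subgroup.zpowers α : Set PSL(2, 𝓞 k)) ≃*
        FreeAbSemidirect (Module.finrank ℚ k - 1))) ∧
    (∀ (r : ℕ) (a : Multiplicative (ZMod 2)) (x : FreeAb r),
      a ≠ 1 → x ≠ 1 → negAction r a x ≠ x) := by
  obtain ⟨A, rfl⟩ := QuotientGroup.mk_surjective α
  -- A single hyperbolic place supplies every nondegeneracy condition on `A` used below.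
  obtain ⟨σ, hσ⟩ : ∃ σ : k →+* ℝ, 4 < σ (intTrace A) ^ 2 := by
    rw [numHyperbolicComponents_mk] at hm
    have hne : Set.ncard {σ : k →+* ℝ | 4 < σ (intTrace A) ^ 2} ≠ 0 := by
      rw [hm]
      omega
    exact Set.nonempty_of_ncard_ne_zero hne
  have ht := intTrace_sq_ne_four hσ
  have ht0 := intTrace_ne_zero hσ
  have hA := isNonscalar_of_intTrace ht
  have hinf := eq_zero_of_zpow_eq_one hσ
  have hconj := psl_conj two_ne_zero ht hinf
  have hflip := psl_flip two_ne_zero ht0 hA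
  have hZ : Infinite (Subgroup.zpowers (A : PSL(2, 𝓞 k))) := by
    refine Set.infinite_coe_iff.mpr (infinite_zpowers.mpr fun h => ?_)
    obtain ⟨n, hn, h1⟩ := isOfFinOrder_iff_pow_eq_one.mp h
    exact hn.ne' (by exact_mod_cast hinf n (by rw [zpow_natCast, h1]))
  have hne : (A : PSL(2, 𝓞 k)) ≠ (A : PSL(2, 𝓞 k))⁻¹ := by
    intro h
    have h2 : (A : PSL(2, 𝓞 k)) ^ (2 : ℤ) = 1 := by
      rw [zpow_ofNat, sq]
      nth_rewrite 2 [h]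
      exact mul_inv_cancel _
    exact two_ne_zero (hinf 2 h2)
  refine ⟨hZ, commensurator_zpowers_eq_normalizer hZ hconj, fun h => ?_, fun h => ?_,
    negAction_ne_self⟩
  · obtain ⟨e⟩ := centralizer_equiv_of_irreducible hσ
      fun ⟨θ, hθ⟩ => h (isHyperbolicParabolic_of_root ht hθ)
    rw [hm] at e
    exact normalizer_zpowers_equiv hne hconj hflip e
  · obtain ⟨θ, hθ⟩ := exists_root_of_isHyperbolicParabolic σ h
    obtain ⟨e⟩ := centralizer_equiv_of_split ht ht0 σ hθ
    exact normalizer_zpowers_equiv hne hconj hflip e
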